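/- **Setting.** A \emph{metric structure} $M$ is a separable metric space $(X,d)$ together with countably many functions $f\colon X^{n}\times\mathbb R^{m}\to X^{k}\times\mathbb R^{l}$ and relations $R\subseteq X^{n}\times\mathbb R^{m}$ ($n,m,k,l\in\mathbb N$ depending on the symbol) such that, for each fixed value of the real arguments, the functions are continuous and the relations are closed in the arguments from $X$. It is \emph{complete} if $(X,d)$ is. $\mathrm{Aut}(M)$ is the group of isometric bijections of $X$ preserving all functions and relations (reals are fixed), with the topology of pointwise convergence. A \emph{finitely generated substructure} is the two-sorted closure under $d$ and the functions of a finite (possibly empty) subset of $X$; isomorphisms of substructures preserve $d$, all functions and all relations and fix reals. For tuples $\bar a,\bar b$, $\mathrm{qftp}(\bar b/\bar a)$ is the set of quantifier-free formulas (built from equalities and relations between terms, in the function symbols and $d$, with arbitrary real constants, by $\neg$ and $\vee$) $\varphi(\bar x,\bar a)$ true of $\bar b$, and $\mathrm{qftp}(\bar b)=\mathrm{qftp}(\bar b/\emptyset)$; $p(X)$ is the set of tuples realizing $p$; $d(\bar a,\bar b)<\varepsilon$ means $d(a_i,b_i)<\varepsilon$ for all $i$. * $M$ is \emph{homogeneous}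 if every isomorphism between finitely generated substructures extends to an automorphism of $M$. * $M$ has \emph{locally finite automorphisms} if for every finitely generated substructure $N$ and all isomorphisms $\varphi_1,\dots,\varphi_n$ between finitely generated substructures of $N$ there is a finitely generated substructure $N'\supseteq N$ such that each $\varphi_i$ extends to an automorphism of $N'$. * $M$ has the \emph{extension property} if for all finitely generated substructures $A\subseteq B\cap C$ there is a finitely generated substructure $C'$ with $C'\equiv_A C$ (some enumerations of $C$ and $C'$ have the same quantifier-free type over $A$) such that any automorphisms $\varphi$ of $B$ and $\psi$ of $C'$, under both of which $A$ is closed and which agree on $A$, have a common extension to an automorphism of the substructure generated by $B\cup C'$. Let $\bar a\in X^k$, $p=\mathrm{qftp}(\bar a)$, $\varepsilon>0$, $m\in\mathbb N$. A set $Y\subseteq p(X)$ is \emph{relatively $\varepsilon$-saturated over $\bar a$} if it realizes every quantifier-free $k$-type $q(\bar x)$ over $\bar a$ that is realized in $X$, contains $p(\bar x)$ and contains, for each $i\le k$, a formula $d(x_i,a_i)=\varepsilon_i$ with $0\le\varepsilon_i<\varepsilon$. A set $Y\subseteq p(X)$ is \emph{$m$-relatively $\varepsilon$-saturated over $\bar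 a$} if $\bar a\in Y$ and there is $T\subseteq p(X)$ such that (i) for every $\bar b\in T$ with $d(\bar b,\bar a)<\varepsilon$ there is $\bar b'\in Y$ with $\mathrm{qftp}(\bar b/\bar a)=\mathrm{qftp}(\bar b'/\bar a)$; (ii) there is a nonempty open $U\subseteq p(X)$ such that every $\bar b\in U$ is $g_m\cdots g_1(\bar a)$ for some $g_1,\dots,g_m\in\mathrm{Aut}(M)$ with $g_i(\bar a)\in T$ and $d(g_i(\bar a),\bar a)<\varepsilon$ for all $i\le m$. A sequence $(\bar a_n)_{n\in\mathbb N}$ in $p(X)$ is \emph{isolated in $p$} (resp. \emph{$m$-weakly isolated in $p$}) if there are $\varepsilon_n>0$ and $Y_n\subseteq p(X)$, with $Y_n$ relatively (resp. $m$-relatively) $\varepsilon_n$-saturated over $\bar a_n$, such that for every sequence $\bar b_n\in Y_n$ with $\mathrm{qftp}(\bar b_n)=\mathrm{qftp}(\bar a_n)$ and $d(\bar a_n,\bar b_n)<\varepsilon_n$ there is one $\varphi\in\mathrm{Aut}(M)$ with $\varphi(\bar a_n)=\bar b_n$ for all $n$. $M$ \emph{admits isolated} (resp. \emph{$m$-weakly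 isolated}) \emph{sequences} if for every $k$, every complete quantifier-free $k$-type $p$ realized in $X$ and every nonmeager $Z\subseteq p(X)$ there is a sequence of elements of $Z$ which is isolated (resp. $m$-weakly isolated) in $p$. $M$ \emph{admits weakly isolated sequences} if it admits $m$-weakly isolated sequences for some $m\in\mathbb N$. A topological group $G$ is \emph{$k$-Steinhaus} ($k\ge1$) if for every $S\subseteq G$ with $S=S^{-1}$ such that countably many left translates of $S$ cover $G$, the set $S^k$ contains a nonempty open subset of $G$. $G$ has the \emph{automatic continuity property} if every group homomorphism from $G$ to a separable topological group is continuous. **Theorem.** Let $M$ be a complete homogeneous metric structure with locally finite automorphisms and the extension property. 1. If $M$ admits $m$-weakly isolated sequences, where $m\in\mathbb N$, then $\mathrm{Aut}(M)$ is $(24m+10)$-Steinhaus. 2. If $M$ admits isolated sequences, then $\mathrm{Aut}(M)$ is $24$-Steinhaus. 3. If $M$ admits weakly isolated sequences, then $\mathrm{Aut}(M)$ has the automatic continuity property. -/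

import Mathlib

open scoped Pointwise

universe u v w

/-- The symbols of a two-sorted metric structure: countably many function symbols
`f : X ^ ptIn × ℝ ^ realIn → X ^ ptOut × ℝ ^ realOut` and countably many relation symbols on
`X ^ relPt × ℝ ^ relReal`. The metric is a further, implicit, function symbol. -/
structure MetricSignature where
  Func : Type
  countable_func : Countable Func
  ptIn : Func → ℕ
  realIn : Func → ℕ
  ptOut : Func → ℕ
  realOut : Func → ℕ
  Rel : Type
  countable_rel : Countable Rel
  relPt : Rel → ℕ
  relReal : Rel → ℕ

/-- An interpretation of the signature `L` on a metric space `X`. The real sort carries the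
discrete topology on the input side, so closedness of relations and continuity of functions are
required for every fixed value of the real arguments. -/
structure MetricStructure (L : MetricSignature) (X : Type u) [MetricSpace X] where
  /-- the `X`-valued coordinates of a function -/
  funPt : ∀ f : L.Func, (Fin (L.ptIn f) → X) → (Fin (L.realIn f) → ℝ) → Fin (L.ptOut f) → X
  /-- the real-valued coordinates of a function -/
  funReal : ∀ f : L.Func, (Fin (L.ptIn f) → X) → (Fin (L.realIn f) → ℝ) → Fin (L.realOut f) → ℝ
  rel : ∀ R : L.Rel, (Fin (L.relPt R) → X) → (Fin (L.relReal R) → ℝ) → Prop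
  continuous_funPt : ∀ f r, Continuous fun x => funPt f x r
  continuous_funReal : ∀ f r, Continuous fun x => funReal f x r
  isClosed_rel : ∀ R r, IsClosed {x | rel R x r}

/-! ### Quantifier-free formulas -/

mutual
/-- Terms of the first sort, with variables indexed by `V`. -/
inductive PtTerm (L : MetricSignature) (V : Type v) : Type v
  | var : V → PtTerm L V
  | func : (f : L.Func) → (Fin (L.ptIn f) → PtTerm L V) → (Fin (L.realIn f) → RealTerm L V) →
      Fin (L.ptOut f) → PtTerm L V
/-- Terms of the real sort; every real number is allowed as a constant. -/
inductive RealTerm (L : MetricSignature) (V : Type v) : Type v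
  | const : ℝ → RealTerm L V
  | dist : PtTerm L V → PtTerm L V → RealTerm L V
  | func : (f : L.Func) → (Fin (L.ptIn f) → PtTerm L V) → (Fin (L.realIn f) → RealTerm L V) →
      Fin (L.realOut f) → RealTerm L V
end

/-- Quantifier-free formulas with variables of the first sort indexed by `V`. -/
inductive QFFormula (L : MetricSignature) (V : Type v) : Type v
  | eqPt : PtTerm L V → PtTerm L V → QFFormula L V
  | eqReal : RealTerm L V → RealTerm L V → QFFormula L V
  | rel : (R : L.Rel) → (Fin (L.relPt R) → PtTerm L V) → (Fin (L.relReal R) → RealTerm L V) →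
      QFFormula L V
  | not : QFFormula L V → QFFormula L V
  | or : QFFormula L V → QFFormula L V → QFFormula L V

mutual
/-- Substitution of variables in a term of the first sort. -/
def PtTerm.rename {L : MetricSignature} {V : Type v} {W : Type w} (h : V → W) :
    PtTerm L V → PtTerm L W
  | .var x => .var (h x)
  | .func f s t i => .func f (fun j => (s j).rename h) (fun j => (t j).rename h) i
/-- Substitution of variables in a term of the real sort. -/
def RealTerm.rename {L : MetricSignature} {V : Type v} {W : Type w} (h : V → W) :
    RealTerm L V → RealTerm L W
  | .const r => .const r
  | .dist s t => .dist (s.rename h) (t.rename h)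
  | .func f s t i => .func f (fun j => (s j).rename h) (fun j => (t j).rename h) i
end

/-- Substitution of variables in a quantifier-free formula. -/
def QFFormula.rename {L : MetricSignature} {V : Type v} {W : Type w} (h : V → W) :
    QFFormula L V → QFFormula L W
  | .eqPt s t => .eqPt (s.rename h) (t.rename h)
  | .eqReal s t => .eqReal (s.rename h) (t.rename h)
  | .rel R s t => .rel R (fun j => (s j).rename h) (fun j => (t j).rename h)
  | .not φ => .not (φ.rename h)
  | .or φ ψ => .or (φ.rename h) (ψ.rename h)

mutual
/-- Value of a term of the first sort under the assignment `b`. -/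
def PtTerm.eval {L : MetricSignature} {X : Type u} [MetricSpace X] {V : Type v}
    (M : MetricStructure L X) (b : V → X) : PtTerm L V → X
  | .var x => b x
  | .func f s t i => M.funPt f (fun j => (s j).eval M b) (fun j => ((t j).evalUp M b).down) i
/-- Value of a term of the real sort under the assignment `b`, lifted to the universe of `X`. -/
def RealTerm.evalUp {L : MetricSignature} {X : Type u} [MetricSpace X] {V : Type v}
    (M : MetricStructure L X) (b : V → X) : RealTerm L V → ULift.{u} ℝ
  | .const r => ⟨r⟩
  | .dist s t => ⟨Dist.dist (s.eval M b) (t.eval M b)⟩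
  | .func f s t i =>
      ⟨M.funReal f (fun j => (s j).eval M b) (fun j => ((t j).evalUp M b).down) i⟩
end

/-- Value of a term of the real sort under the assignment `b`. -/
def RealTerm.eval {L : MetricSignature} {X : Type u} [MetricSpace X] {V : Type v}
    (M : MetricStructure L X) (b : V → X) (t : RealTerm L V) : ℝ :=
  (t.evalUp M b).down

/-- Satisfaction of a quantifier-free formula under the assignment `b`. -/
def QFFormula.Holds {L : MetricSignature} {X : Type u} [MetricSpace X] {V : Type v}
    (M : MetricStructure L X) (b : V → X) : QFFormula L V → Prop
  | .eqPt s t => s.eval M b = t.eval M b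
  | .eqReal s t => s.eval M b = t.eval M b
  | .rel R s t => M.rel R (fun j => (s j).eval M b) (fun j => (t j).eval M b)
  | .not φ => ¬ φ.Holds M b
  | .or φ ψ => φ.Holds M b ∨ ψ.Holds M b

namespace MetricStructure

variable {L : MetricSignature} {X : Type u} [MetricSpace X]

/-! ### Types -/

/-- The quantifier-free type `qftp(b)` of a tuple `b` indexed by `V`. -/
def qftp {V : Type v} (M : MetricStructure L X) (b : V → X) : Set (QFFormula L V) :=
  {φ | φ.Holds M b}

/-- The quantifier-free type `qftp(b / a)` of `b` over `a`: variables are on the left of the sum,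
parameters on the right. -/
def qftpOver {V : Type v} {W : Type w} (M : MetricStructure L X) (b : V → X) (a : W → X) :
    Set (QFFormula L (V ⊕ W)) :=
  M.qftp (Sum.elim b a)

/-- `p(X)`, the set of tuples realizing `p`. -/
def realizations {V : Type v} (M : MetricStructure L X) (p : Set (QFFormula L V)) : Set (V → X) :=
  {b | ∀ φ ∈ p, φ.Holds M b}

/-- `p` is an `ε`-quantifier-free `k`-type over `a`: it contains `qftp(a)`, and for each `i` it
contains the formula `d(x_i, a_i) = ε_i` for some `0 ≤ ε_i < ε`. -/
def IsEpsType {k : ℕ} (M : MetricStructure L X) (ε : ℝ) (a : Fin k → X)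
    (p : Set (QFFormula L (Fin k ⊕ Fin k))) : Prop :=
  (∀ φ ∈ M.qftp a, φ.rename Sum.inl ∈ p) ∧
  ∀ i : Fin k, ∃ e : ℝ, 0 ≤ e ∧ e < ε ∧
    QFFormula.eqReal (.dist (.var (Sum.inl i)) (.var (Sum.inr i))) (.const e) ∈ p

/-! ### Automorphisms -/

/-- The automorphism group: isometric bijections preserving all functions and relations. The
automorphisms fix the real sort pointwise. -/
def aut (M : MetricStructure L X) : Subgroup (X ≃ᵢ X) where
  carrier := {g |
    (∀ f x r i, M.funPt f (fun j => g (x j)) r i = g (M.funPt f x r i)) ∧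
    (∀ f x r i, M.funReal f (fun j => g (x j)) r i = M.funReal f x r i) ∧
    (∀ R x r, M.rel R (fun j => g (x j)) r ↔ M.rel R x r)}
  one_mem' := ⟨fun _ _ _ _ => rfl, fun _ _ _ _ => rfl, fun _ _ _ => Iff.rfl⟩
  mul_mem' := by
    rintro a b ⟨ha1, ha2, ha3⟩ ⟨hb1, hb2, hb3⟩
    refine ⟨fun f x r i => ?_, fun f x r i => ?_, fun R x r => ?_⟩
    · simp only [IsometryEquiv.mul_apply]
      rw [ha1 f (fun j => b (x j)) r i, hb1]
    · simp only [IsometryEquiv.mul_apply]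
      rw [ha2 f (fun j => b (x j)) r i, hb2]
    · simp only [IsometryEquiv.mul_apply]
      rw [ha3 R (fun j => b (x j)) r, hb3]
  inv_mem' := by
    rintro a ⟨h1, h2, h3⟩
    refine ⟨fun f x r i => ?_, fun f x r i => ?_, fun R x r => ?_⟩
    · have h := h1 f (fun j => a⁻¹ (x j)) r i
      simp only [IsometryEquiv.apply_inv_self] at h
      rw [h, IsometryEquiv.inv_apply_self]
    · have h := h2 f (fun j => a⁻¹ (x j)) r i
      simp only [IsometryEquiv.apply_inv_self] at h
      exact h.symm
    · have h := h3 R (fun j => a⁻¹ (x j)) r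
      simp only [IsometryEquiv.apply_inv_self] at h
      exact h.symm

/-- The topology of pointwise convergence on the automorphism group. -/
instance autTopology (M : MetricStructure L X) : TopologicalSpace M.aut :=
  TopologicalSpace.induced (fun (g : M.aut) (x : X) => g.1 x) inferInstance

/-! ### Finitely generated substructures and partial isomorphisms -/

mutual
/-- The elements of the first sort of the substructure generated by `F`. -/
inductive GenPt (M : MetricStructure L X) (F : Set X) : X → Prop
  | basic (x : X) (hx : x ∈ F) : GenPt M F x
  | func (f : L.Func) (x : Fin (L.ptIn f) → X) (r : Fin (L.realIn f) → ℝ) (i : Fin (L.ptOut f))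
      (hx : ∀ j, GenPt M F (x j)) (hr : ∀ j, GenReal M F (r j)) : GenPt M F (M.funPt f x r i)
/-- The elements of the real sort of the substructure generated by `F`. -/
inductive GenReal (M : MetricStructure L X) (F : Set X) : ℝ → Prop
  | dist (x y : X) (hx : GenPt M F x) (hy : GenPt M F y) : GenReal M F (Dist.dist x y)
  | func (f : L.Func) (x : Fin (L.ptIn f) → X) (r : Fin (L.realIn f) → ℝ) (i : Fin (L.realOut f))
      (hx : ∀ j, GenPt M F (x j)) (hr : ∀ j, GenReal M F (r j)) : GenReal M F (M.funReal f x r i)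
end

/-- The first sort of the substructure generated by `F`. -/
def gen (M : MetricStructure L X) (F : Set X) : Set X := {x | M.GenPt F x}

/-- `A` is (the first sort of) a finitely generated substructure. Its real sort is then
`{r | M.GenReal A r}`. -/
def IsFG (M : MetricStructure L X) (A : Set X) : Prop :=
  ∃ F : Set X, F.Finite ∧ A = M.gen F

/-- `φ` is an isomorphism of substructures: it preserves the metric, the functions and the
relations, the real arguments ranging over the real sort of `A`. -/
structure IsIso (M : MetricStructure L X) {A B : Set X} (φ : A ≃ B) : Prop where
  dist_eq : ∀ x y : A, dist (φ x : X) (φ y) = dist (x : X) y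
  funPt_eq : ∀ (f : L.Func) (x : Fin (L.ptIn f) → A) (r : Fin (L.realIn f) → ℝ),
    (∀ j, M.GenReal A (r j)) → ∀ (i : Fin (L.ptOut f)) (y : A),
    M.funPt f (fun j => x j) r i = y → M.funPt f (fun j => φ (x j)) r i = φ y
  funReal_eq : ∀ (f : L.Func) (x : Fin (L.ptIn f) → A) (r : Fin (L.realIn f) → ℝ),
    (∀ j, M.GenReal A (r j)) → ∀ i : Fin (L.realOut f),
    M.funReal f (fun j => φ (x j)) r i = M.funReal f (fun j => x j) r i
  rel_iff : ∀ (R : L.Rel) (x : Fin (L.relPt R) → A) (r : Fin (L.relReal R) → ℝ),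
    (∀ j, M.GenReal A (r j)) → (M.rel R (fun j => φ (x j)) r ↔ M.rel R (fun j => x j) r)

/-- Every isomorphism between finitely generated substructures extends to an automorphism. -/
def Homogeneous (M : MetricStructure L X) : Prop :=
  ∀ A B : Set X, M.IsFG A → M.IsFG B → ∀ φ : A ≃ B, M.IsIso φ →
    ∃ g ∈ M.aut, ∀ x : A, g x = φ x

/-- Finitely many partial automorphisms of a finitely generated substructure `N` (isomorphisms
between finitely generated substructures of `N`) extend to automorphisms of a common finitely
generated substructure containing `N`. -/
def LocallyFiniteAut (M : MetricStructure L X) : Prop :=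
  ∀ (n : ℕ) (N : Set X), M.IsFG N →
    ∀ D E : Fin n → Set X, (∀ i, M.IsFG (D i) ∧ D i ⊆ N) → (∀ i, M.IsFG (E i) ∧ E i ⊆ N) →
    ∀ φ : ∀ i, D i ≃ E i, (∀ i, M.IsIso (φ i)) →
    ∃ N' : Set X, M.IsFG N' ∧ N ⊆ N' ∧
      ∀ i, ∃ ψ : N' ≃ N', M.IsIso ψ ∧
        ∀ (x : D i) (y : N'), (y : X) = x → (ψ y : X) = φ i x

/-- `B` and `C` are independent over `A`: any automorphisms `φ` of `B` and `ψ` of `C` under which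
`A` is closed and which agree on `A` have a common extension to an automorphism of the
substructure generated by `B` and `C`. -/
def Indep (M : MetricStructure L X) (A B C : Set X) : Prop :=
  ∀ (φ : B ≃ B) (ψ : C ≃ C), M.IsIso φ → M.IsIso ψ →
    (∀ x : B, (x : X) ∈ A → (φ x : X) ∈ A) →
    (∀ x : C, (x : X) ∈ A → (ψ x : X) ∈ A) →
    (∀ (x : B) (y : C), (x : X) ∈ A → (x : X) = y → (φ x : X) = ψ y) →
    ∃ χ : M.gen (B ∪ C) ≃ M.gen (B ∪ C), M.IsIso χ ∧
      (∀ (x : B) (z : M.gen (B ∪ C)), (z : X) = x → (χ z : X) = φ x) ∧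
      (∀ (y : C) (z : M.gen (B ∪ C)), (z : X) = y → (χ z : X) = ψ y)

/-- The extension property. Substructures are enumerated (here: by the points of `C`), so
`C' ≡_A C` says that `C'` has an enumeration `e` with the same type over `A` as `C`. -/
def ExtensionProperty (M : MetricStructure L X) : Prop :=
  ∀ A B C : Set X, M.IsFG A → M.IsFG B → M.IsFG C → A ⊆ B ∩ C →
    ∃ C' : Set X, M.IsFG C' ∧
      (∃ e : C → X, Set.range e = C' ∧
        M.qftpOver e ((↑) : A → X) = M.qftpOver ((↑) : C → X) ((↑) : A → X)) ∧
      M.Indep A B C'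

/-! ### Isolated and weakly isolated sequences -/

/-- `Y ⊆ p(X)`, `p = qftp(a)`, is relatively `ε`-saturated over `a`. -/
def RelSaturated {k : ℕ} (M : MetricStructure L X) (ε : ℝ) (a : Fin k → X)
    (Y : Set (Fin k → X)) : Prop :=
  Y ⊆ M.realizations (M.qftp a) ∧
  ∀ p : Set (QFFormula L (Fin k ⊕ Fin k)), M.IsEpsType ε a p →
    (∃ b : Fin k → X, Sum.elim b a ∈ M.realizations p) →
    ∃ b ∈ Y, Sum.elim b a ∈ M.realizations p

/-- `Y` is `T`-relatively `ε`-saturated over `a`. -/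
def TRelSaturated {k : ℕ} (M : MetricStructure L X) (ε : ℝ) (a : Fin k → X)
    (T Y : Set (Fin k → X)) : Prop :=
  ∀ b ∈ T, (∀ i, dist (b i) (a i) < ε) → ∃ b' ∈ Y, M.qftpOver b a = M.qftpOver b' a

/-- `T ⊆ p(X)`, `p = qftp(a)`, `(m, ε)`-generates an open set over `a`. The product of the reversed
list is `g_m ⋯ g_1`. -/
def GeneratesOpen {k : ℕ} (M : MetricStructure L X) (m : ℕ) (ε : ℝ) (a : Fin k → X)
    (T : Set (Fin k → X)) : Prop :=
  ∃ U : Set (M.realizations (M.qftp a)), IsOpen U ∧ U.Nonempty ∧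
    ∀ b ∈ U, ∃ g : Fin m → M.aut,
      (∀ j, ((List.ofFn g).reverse.prod : M.aut).1 (a j) = b.1 j) ∧
      ∀ i, (fun j => (g i).1 (a j)) ∈ T ∧ ∀ j, dist ((g i).1 (a j)) (a j) < ε

/-- `Y ⊆ p(X)`, `p = qftp(a)`, is `m`-relatively `ε`-saturated over `a`. Such a set is understood
to contain `a`, as relatively `ε`-saturated sets automatically do. -/
def MRelSaturated {k : ℕ} (M : MetricStructure L X) (m : ℕ) (ε : ℝ) (a : Fin k → X)
    (Y : Set (Fin k → X)) : Prop :=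
  Y ⊆ M.realizations (M.qftp a) ∧ a ∈ Y ∧
  ∃ T ⊆ M.realizations (M.qftp a), M.TRelSaturated ε a T Y ∧ M.GeneratesOpen m ε a T

/-- The common part of the two notions of isolation: any choice of realizations `b n ∈ Y n` of
`qftp(a n)` which are `ε n`-close to `a n` is the image of `a` under a single automorphism. -/
def SimultaneouslyExtends {k : ℕ} (M : MetricStructure L X) (ε : ℕ → ℝ) (a : ℕ → Fin k → X)
    (Y : ℕ → Set (Fin k → X)) : Prop :=
  ∀ b : ℕ → Fin k → X,
    (∀ n, b n ∈ Y n ∧ M.qftp (b n) = M.qftp (a n) ∧ ∀ i, dist (a n i) (b n i) < ε n) →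
    ∃ g ∈ M.aut, ∀ n i, g (a n i) = b n i

/-- `a` is an isolated sequence in `p`. -/
def IsolatedSeq {k : ℕ} (M : MetricStructure L X) (p : Set (QFFormula L (Fin k)))
    (a : ℕ → Fin k → X) : Prop :=
  (∀ n, a n ∈ M.realizations p) ∧
  ∃ (ε : ℕ → ℝ) (Y : ℕ → Set (Fin k → X)),
    (∀ n, 0 < ε n ∧ Y n ⊆ M.realizations p ∧ M.RelSaturated (ε n) (a n) (Y n)) ∧
    M.SimultaneouslyExtends ε a Y

/-- `a` is an `m`-weakly isolated sequence in `p`. -/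
def WeaklyIsolatedSeq {k : ℕ} (M : MetricStructure L X) (m : ℕ) (p : Set (QFFormula L (Fin k)))
    (a : ℕ → Fin k → X) : Prop :=
  (∀ n, a n ∈ M.realizations p) ∧
  ∃ (ε : ℕ → ℝ) (Y : ℕ → Set (Fin k → X)),
    (∀ n, 0 < ε n ∧ Y n ⊆ M.realizations p ∧ M.MRelSaturated m (ε n) (a n) (Y n)) ∧
    M.SimultaneouslyExtends ε a Y

/-- `M` admits isolated sequences. The complete quantifier-free `k`-types realized in `M` are
exactly the types `qftp(a)` of `k`-tuples `a` of `M`. -/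
def AdmitsIsolated (M : MetricStructure L X) : Prop :=
  ∀ (k : ℕ) (a : Fin k → X) (Z : Set (M.realizations (M.qftp a))), ¬ IsMeagre Z →
    ∃ s : ℕ → Fin k → X, M.IsolatedSeq (M.qftp a) s ∧ ∀ n, s n ∈ Subtype.val '' Z

/-- `M` admits `m`-weakly isolated sequences. -/
def AdmitsMWeaklyIsolated (M : MetricStructure L X) (m : ℕ) : Prop :=
  ∀ (k : ℕ) (a : Fin k → X) (Z : Set (M.realizations (M.qftp a))), ¬ IsMeagre Z →
    ∃ s : ℕ → Fin k → X, M.WeaklyIsolatedSeq m (M.qftp a) s ∧ ∀ n, s n ∈ Subtype.val '' Z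

/-- `M` admits weakly isolated sequences. -/
def AdmitsWeaklyIsolated (M : MetricStructure L X) : Prop :=
  ∃ m : ℕ, M.AdmitsMWeaklyIsolated m

end MetricStructure

/-! ### Steinhaus groups and automatic continuity -/

/-- Countably many left translates of `S` cover the group. -/
def CountablySyndetic {G : Type u} [Group G] (S : Set G) : Prop :=
  ∃ a : ℕ → G, ⋃ n, a n • S = Set.univ

/-- `G` is `k`-Steinhaus; `S ^ k` is the set of products of `k` elements of `S`. -/
def IsSteinhausWith (G : Type u) [Group G] [TopologicalSpace G] (k : ℕ) : Prop :=
  1 ≤ k ∧ ∀ S : Set G, S⁻¹ = S → CountablySyndetic S →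
    ∃ U : Set G, IsOpen U ∧ U.Nonempty ∧ U ⊆ S ^ k

/-- Every homomorphism from `G` to a separable topological group is continuous. -/
def AutomaticContinuity (G : Type u) [Group G] [TopologicalSpace G] : Prop :=
  ∀ (H : Type v) [Group H] [TopologicalSpace H] [IsTopologicalGroup H]
    [TopologicalSpace.SeparableSpace H] (φ : G →* H), Continuous φ

-- Let `W` be symmetric with countably many left translates covering `Aut(M)`. The proof has two
-- halves: `W ^ 8` contains the pointwise stabilizer of a finite set, and weakly isolated sequences
-- inflate such a stabilizer to an open set.
--
-- For the first half, suppose a group `Γ` acts faithfully on a countable set `D`, is closed under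
-- pointwise limits, and has local finiteness and the extension property for a closure operator
-- (`AmpleAction`). Call a tuple generic if its invariant finitely generated sets are cofinal and it
-- realizes every finite extension of its restriction to such a set. A generic tuple stays generic
-- after adjoining a residual choice of one more element (`genericTuple_cons_residual`), and generic
-- tuples agreeing on a common invariant set are conjugate over it (`generic_conj`). By Baire
-- category some `w⁻¹ W`, with `w ∈ W`, is nonmeager in every open piece of the stabilizer of a
-- finite set `F`; for `g` fixing `F` the same holds for `g w⁻¹ W`. Generic conjugation then builds
-- a Cantor scheme of elements `h α` such that `h α` and `h β` conjugate an element of `w⁻¹ W` and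
-- one of `g w⁻¹ W` to the same element (`exists_conj_tree`). There are uncountably many branches
-- and countably many translates, so some `h α`, `h β` lie in one translate of `W`, and unwinding
-- the conjugacy writes `g` as a product of eight elements of `W`.
--
-- The space `X` need not be countable, so a Löwenheim–Skolem argument (`exists_isWitnessClosed`)
-- yields a countable dense `D` and a group `S` of automorphisms preserving it that contain all
-- required witnesses. The closure `Γ` of `S` for pointwise convergence on the discrete set `D` is
-- ample, with completeness of `X` providing limits. The hull also reflects failure of "the
-- stabilizer of `A` lies in `W ^ 8`" into `S`, so the result for `Γ` returns to `Aut(M)`.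
--
-- For the second half, enumerate the finite set as `a` and let `H` be its stabilizer. The set `W a`
-- is nonmeager in the complete space of realizations of `qftp(a)`, so it contains a weakly isolated
-- sequence. A diagonal argument gives an index at which all nearby moves into the saturated set are
-- made by a single translate of `W`. Relative saturation then writes every small move as
-- (stabilizer) · `W ^ 2` · (stabilizer). Composing `m` such moves and conjugating back to `a` puts
-- an open set inside `H W ^ (12 m) ⊆ W ^ (12 m + 8)` (`Homogeneous.exists_isOpen_subset_pow`).
-- Isolated sequences are the case `m = 1`, and automatic continuity follows from any Steinhaus
-- exponent.

/-! ### Ample actions on a countable set -/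

/-- An action on a set `D` with a closure operator, closed under pointwise limits, whose finitely
generated closed sets have locally finite automorphisms and the extension property. -/
structure AmpleAction (Γ : Type u) {D : Type v} [Group Γ] [MulAction Γ D]
    (cl : Set D → Set D) : Prop where
  subset_cl : ∀ s, s ⊆ cl s
  cl_subset : ∀ s t, s ⊆ cl t → cl s ⊆ cl t
  smul_cl : ∀ (g : Γ) s, g • cl s = cl (g • s)
  fix_cl : ∀ (g : Γ) s, (∀ d ∈ s, g • d = d) → ∀ d ∈ cl s, g • d = d
  complete : ∀ p q : D → D,
    (∀ F : Finset D, ∃ g : Γ, ∀ d ∈ F, g • d = p d ∧ g⁻¹ • d = q d) → ∃ g : Γ, ∀ d, g • d = p d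
  locallyFinite : ∀ (n : ℕ) (F : Finset D) (g : Fin n → Γ), ∃ N : Finset D, F ⊆ N ∧
    ∃ h : Fin n → Γ, ∀ i, (∀ d ∈ F, h i • d = g i • d) ∧ h i • cl N = cl N
  extension : ∀ A B C : Finset D, (A : Set D) ⊆ cl B → (A : Set D) ⊆ cl C →
    ∃ k : Γ, (∀ d ∈ A, k • d = d) ∧ ∀ φ ψ : Γ, φ • cl A = cl A → φ • cl B = cl B →
      ψ • cl (k • (C : Set D)) = cl (k • (C : Set D)) → (∀ d ∈ A, φ • d = ψ • d) →
      ∃ χ : Γ, (∀ d ∈ B, χ • d = φ • d) ∧ ∀ d ∈ C, χ • k • d = ψ • k • d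

/-- The topology of pointwise convergence of an action on a discrete set. -/
@[reducible] def discretePointwise (Γ : Type u) (D : Type v) [Group Γ] [MulAction Γ D] :
    TopologicalSpace Γ where
  IsOpen U := ∀ g ∈ U, ∃ E : Finset D, ∀ g' : Γ, (∀ d ∈ E, g' • d = g • d) → g' ∈ U
  isOpen_univ := fun _ _ => ⟨∅, fun _ _ => trivial⟩
  isOpen_inter := by
    classical
    rintro s t hs ht g ⟨hgs, hgt⟩
    obtain ⟨E, hE⟩ := hs g hgs
    obtain ⟨F, hF⟩ := ht g hgt
    exact ⟨E ∪ F, fun g' h => ⟨hE g' fun d hd => h d (Finset.mem_union_left _ hd),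
      hF g' fun d hd => h d (Finset.mem_union_right _ hd)⟩⟩
  isOpen_sUnion := by
    rintro S hS g ⟨t, ht, hgt⟩
    obtain ⟨E, hE⟩ := hS t ht g hgt
    exact ⟨E, fun g' h => ⟨t, ht, hE g' h⟩⟩

namespace AmpleAction

variable {Γ : Type u} {D : Type v} [Group Γ] [MulAction Γ D] {cl : Set D → Set D}

theorem agree_cl (H : AmpleAction Γ cl) {g h : Γ} {s : Set D} (hs : ∀ d ∈ s, g • d = h • d) :
    ∀ d ∈ cl s, g • d = h • d := by
  intro d hd
  have := H.fix_cl (h⁻¹ * g) s (fun d hd => by rw [mul_smul, hs d hd, inv_smul_smul]) d hd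
  rwa [mul_smul, inv_smul_eq_iff] at this

theorem smul_cl_congr (H : AmpleAction Γ cl) {g h : Γ} {s : Set D}
    (hs : ∀ d ∈ s, g • d = h • d) : g • cl s = h • cl s :=
  Set.image_congr (H.agree_cl hs)

theorem cl_mono (H : AmpleAction Γ cl) {s t : Set D} (h : s ⊆ t) : cl s ⊆ cl t :=
  H.cl_subset _ _ (h.trans (H.subset_cl t))

/-- The values of `f n` on `A n` are final, so `h1` makes `f n` converge pointwise, and `h2` does
the same for the inverses. Without the latter the limit might fail to be surjective. -/
theorem exists_limit (H : AmpleAction Γ cl) (f : ℕ → Γ) (A : ℕ → Finset D)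
    (hA : ∀ n, A n ⊆ A (n + 1)) (hf : ∀ n, ∀ d ∈ A n, f (n + 1) • d = f n • d)
    (h1 : ∀ d, ∃ n, d ∈ A n) (h2 : ∀ d, ∃ n, (f n)⁻¹ • d ∈ A n) :
    ∃ g : Γ, ∀ n, ∀ d ∈ A n, g • d = f n • d := by
  have mono : Monotone A := monotone_nat_of_le_succ hA
  have agree : ∀ n m, n ≤ m → ∀ d ∈ A n, f m • d = f n • d := by
    intro n m hnm
    induction m, hnm using Nat.le_induction with
    | base => intros; rfl
    | succ m hm ih => intro d hd; rw [hf m d (mono hm hd), ih d hd]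
  have agree' : ∀ n m, n ≤ m → ∀ d, (f n)⁻¹ • d ∈ A n → (f m)⁻¹ • d = (f n)⁻¹ • d := by
    intro n m hnm d hd
    rw [inv_smul_eq_iff, agree n m hnm _ hd, smul_inv_smul]
  choose N1 hN1 using h1
  choose N2 hN2 using h2
  obtain ⟨g, hg⟩ := H.complete (fun d => f (N1 d) • d) (fun d => (f (N2 d))⁻¹ • d) (by
    intro F
    refine ⟨f (F.sup fun d => max (N1 d) (N2 d)), fun d hd => ?_⟩
    have hle := Finset.le_sup (f := fun d => max (N1 d) (N2 d)) hd
    exact ⟨agree _ _ ((le_max_left _ _).trans hle) d (hN1 d),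
      agree' _ _ ((le_max_right _ _).trans hle) d (hN2 d)⟩)
  refine ⟨g, fun n d hd => ?_⟩
  rw [hg d]
  rcases le_total n (N1 d) with h | h
  · exact agree _ _ h d hd
  · exact (agree _ _ h d (hN1 d)).symm

/-- The common form of the Baire and the back-and-forth constructions: at stage `n` the finite set
`E` is the `n`-th point of `D`, absorbed into both domain and range. -/
theorem exists_limit_of_step [Countable D] (H : AmpleAction Γ cl) (P : ℕ → Γ → Finset D → Prop)
    {g₀ : Γ} {A₀ : Finset D} (h0 : P 0 g₀ A₀)
    (step : ∀ n g A (E : Finset D), P n g A → ∃ g' A', P (n + 1) g' A' ∧ A ⊆ A' ∧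
      (∀ d ∈ A, g' • d = g • d) ∧ ∀ d ∈ E, d ∈ A' ∧ g'⁻¹ • d ∈ A') :
    ∃ (g : Γ) (f : ℕ → Γ) (A : ℕ → Finset D), f 0 = g₀ ∧ A 0 = A₀ ∧ (∀ n, P n (f n) (A n)) ∧
      Monotone A ∧ (∀ d, ∃ n, d ∈ A n) ∧ ∀ n, ∀ d ∈ A n, g • d = f n • d := by
  classical
  obtain ⟨e⟩ := nonempty_encodable D
  choose g' A' hP hA hf hE using step
  let st : ∀ n, {q : Γ × Finset D // P n q.1 q.2} := fun n =>
    Nat.rec ⟨(g₀, A₀), h0⟩ (fun n q =>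
      ⟨(g' n q.1.1 q.1.2 (Encodable.decode n : Option D).toFinset q.2,
        A' n q.1.1 q.1.2 (Encodable.decode n : Option D).toFinset q.2), hP _ _ _ _ _⟩) n
  have hst : ∀ d : D, d ∈ (st (Encodable.encode d + 1)).1.2 ∧
      (st (Encodable.encode d + 1)).1.1⁻¹ • d ∈ (st (Encodable.encode d + 1)).1.2 := fun d =>
    hE _ _ _ _ (st (Encodable.encode d)).2 d (by simp)
  have hsub : ∀ n, (st n).1.2 ⊆ (st (n + 1)).1.2 := fun n => hA _ _ _ _ (st n).2
  obtain ⟨g, hg⟩ := H.exists_limit (fun n => (st n).1.1) (fun n => (st n).1.2) hsub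
    (fun n => hf _ _ _ _ (st n).2) (fun d => ⟨_, (hst d).1⟩) (fun d => ⟨_, (hst d).2⟩)
  exact ⟨g, fun n => (st n).1.1, fun n => (st n).1.2, rfl, rfl, fun n => (st n).2,
    monotone_nat_of_le_succ hsub, fun d => ⟨_, (hst d).1⟩, hg⟩

/-! ### Category -/

theorem isOpen_agree (g : Γ) (E : Finset D) :
    @IsOpen Γ (discretePointwise Γ D) {g' : Γ | ∀ d ∈ E, g' • d = g • d} :=
  fun _ hg' => ⟨E, fun _ h d hd => (h d hd).trans (hg' d hd)⟩

theorem dense_iff (U : Set Γ) : @Dense Γ (discretePointwise Γ D) U ↔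
    ∀ (g : Γ) (E : Finset D), ∃ g' ∈ U, ∀ d ∈ E, g' • d = g • d := by
  let _ := discretePointwise Γ D
  constructor
  · intro hU g E
    obtain ⟨g', h1, h2⟩ := hU.inter_open_nonempty _ (isOpen_agree g E) ⟨g, fun _ _ => rfl⟩
    exact ⟨g', h2, h1⟩
  · intro h
    rw [dense_iff_inter_open]
    rintro O hO ⟨g, hg⟩
    obtain ⟨E, hE⟩ := hO g hg
    obtain ⟨g', h1, h2⟩ := h g E
    exact ⟨g', hE g' h2, h1⟩

theorem exists_countable_dense_elements (Γ : Type u) (D : Type v) [Group Γ] [MulAction Γ D]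
    [Countable D] : ∃ Q : Set Γ, Q.Countable ∧
      ∀ (g : Γ) (E : Finset D), ∃ q ∈ Q, ∀ d ∈ E, q • d = g • d := by
  classical
  let T := Σ E : Finset D, (E → D)
  let c : T → Γ := fun t => if h : ∃ g : Γ, ∀ d : t.1, g • (d : D) = t.2 d then h.choose else 1
  refine ⟨Set.range c, Set.countable_range c, fun g E =>
    ⟨c ⟨E, fun d => g • (d : D)⟩, ⟨_, rfl⟩, ?_⟩⟩
  have h : ∃ g' : Γ, ∀ d : E, g' • (d : D) = g • (d : D) := ⟨g, fun _ => rfl⟩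
  intro d hd
  have : c ⟨E, fun d => g • (d : D)⟩ = h.choose := dif_pos h
  rw [this]
  exact h.choose_spec ⟨d, hd⟩

/-- The usual nested-neighbourhood argument: stage `n` enters the `n`-th dense open set and freezes
enough values to stay there, and the limit exists because the action is complete. -/
theorem baireSpace [Countable D] (H : AmpleAction Γ cl) :
    @BaireSpace Γ (discretePointwise Γ D) := by
  classical
  let _ := discretePointwise Γ D
  refine ⟨fun U hU hd => ?_⟩
  rw [dense_iff (D := D)]
  intro g₀ A₀
  obtain ⟨g, f, A, hf0, hA0, hP, -, -, hg⟩ := H.exists_limit_of_step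
    (fun n f A => ∀ i < n, ∀ g' : Γ, (∀ d ∈ A, g' • d = f • d) → g' ∈ U i) (g₀ := g₀) (A₀ := A₀)
    (fun i hi => absurd hi (Nat.not_lt_zero i)) (by
      intro n g A E hP
      obtain ⟨g', hg'U, hg'⟩ := (dense_iff (D := D) (U n)).1 (hd n) g A
      obtain ⟨F, hF⟩ := hU n g' hg'U
      refine ⟨g', A ∪ F ∪ E ∪ E.image (g'⁻¹ • ·), ?_, ?_, hg', ?_⟩
      · intro i hi h hh
        rcases Nat.lt_succ_iff_lt_or_eq.1 hi with hi | rfl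
        · exact hP i hi h fun d hd => (hh d (by simp [hd])).trans (hg' d hd)
        · exact hF h fun d hd => hh d (by simp [hd])
      · intro d hd; simp [hd]
      · intro d hd
        exact ⟨by simp [hd], Finset.mem_union_right _ (Finset.mem_image_of_mem _ hd)⟩)
  refine ⟨g, Set.mem_iInter.2 fun i => hP (i + 1) i (Nat.lt_succ_self i) g (hg _), ?_⟩
  intro d hd
  rw [hg 0 d (hA0 ▸ hd), hf0]

/-- The homeomorphism of left translation. -/
def leftTranslation (D : Type v) [MulAction Γ D] (a : Γ) :
    @Homeomorph Γ Γ (discretePointwise Γ D) (discretePointwise Γ D) :=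
  letI := discretePointwise Γ D
  have cont : ∀ a : Γ, Continuous fun g => a * g := fun a => by
    refine continuous_def.2 fun U hU g hg => ?_
    obtain ⟨E, hE⟩ := hU _ hg
    exact ⟨E, fun g' h => hE _ fun d hd => by rw [mul_smul, mul_smul, h d hd]⟩
  { toEquiv := Equiv.mulLeft a
    continuous_toFun := cont a
    continuous_invFun := cont a⁻¹ }

theorem residual_translate {R : Set Γ} (hR : R ∈ @residual Γ (discretePointwise Γ D)) (a : Γ) :
    {g | a * g ∈ R} ∈ @residual Γ (discretePointwise Γ D) := by
  let _ := discretePointwise Γ D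
  have := (leftTranslation D a).residual_map_eq
  rw [← this] at hR
  exact hR

/-- A set whose countably many left translates cover is, after a translation, non-meager in every
open subset of the stabilizer of a finite set. -/
theorem exists_everywhere_nonmeager [Countable D] (H : AmpleAction Γ cl) {W : Set Γ} {k : ℕ → Γ}
    (hk : ⋃ n, k n • W = Set.univ) :
    ∃ (w : Γ) (F : Finset D), ∀ R ∈ @residual Γ (discretePointwise Γ D), ∀ v : Γ,
      (∀ d ∈ F, v • d = d) → ∀ E : Finset D, ∃ y ∈ R, w * y ∈ W ∧ ∀ d ∈ E, y • d = v • d := by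
  classical
  let _ := discretePointwise Γ D
  have := H.baireSpace
  by_contra! hcon
  obtain ⟨Q, hQc, hQ⟩ := exists_countable_dense_elements Γ D
  have := hQc.to_subtype
  -- `I` indexes the basic open sets in which `W` is meager. If the claim fails at every `(g, F)`,
  -- their union is dense, so `W` is meager, which contradicts the covering by translates.
  let I := {i : Q × Finset D // ∃ R ∈ residual Γ, ∀ y ∈ R, (∀ d ∈ i.2, y • d = i.1.1 • d) → y ∉ W}
  choose R hR hRW using fun i : I => i.2
  let O : Set Γ := ⋃ i : I, {y | ∀ d ∈ i.1.2, y • d = i.1.1.1 • d}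
  have hO : O ∈ residual Γ := by
    refine residual_of_dense_open (isOpen_iUnion fun i => isOpen_agree (D := D) _ _) ?_
    rw [dense_iff (D := D)]
    intro g F
    obtain ⟨R, hR, v, hv, E, hE⟩ := hcon g F
    obtain ⟨q, hqQ, hq⟩ := hQ (g * v) (E ∪ F)
    refine ⟨q, Set.mem_iUnion.2 ⟨⟨(⟨q, hqQ⟩, E), {y | g⁻¹ * y ∈ R}, residual_translate hR _, ?_⟩,
      fun _ _ => rfl⟩, fun d hd => ?_⟩
    · intro y hy hyq hyW
      obtain ⟨d, hd, hne⟩ := hE _ hy (by simpa using hyW)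
      apply hne
      rw [mul_smul, hyq d hd, hq d (by simp [hd]), mul_smul, inv_smul_smul]
    · rw [hq d (by simp [hd]), mul_smul, hv d hd]
  have hW : Wᶜ ∈ residual Γ := by
    filter_upwards [hO, countable_iInter_mem.2 hR] with y hyO hyR
    obtain ⟨i, hi⟩ := Set.mem_iUnion.1 hyO
    exact hRW i y (Set.mem_iInter.1 hyR i) hi
  have hall : ⋂ n, {g | (k n)⁻¹ * g ∈ Wᶜ} ∈ residual Γ :=
    countable_iInter_mem.2 fun n => residual_translate hW _
  obtain ⟨g, hg⟩ := (dense_of_mem_residual hall).nonempty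
  obtain ⟨n, hn⟩ := Set.mem_iUnion.1 (hk.symm ▸ Set.mem_univ g : g ∈ ⋃ n, k n • W)
  exact Set.mem_iInter.1 hg n (by simpa [Set.mem_smul_set_iff_inv_smul_mem] using hn)

end AmpleAction

/-! ### Generic tuples -/

/-- A tuple of group elements is generic over `cl`: finitely generated closed sets which are
invariant under it are cofinal, and it realizes, up to conjugation, every finite extension of its
restriction to such a set. -/
structure GenericTuple {Γ : Type u} {D : Type v} [Group Γ] [MulAction Γ D]
    (cl : Set D → Set D) {n : ℕ} (x : Fin n → Γ) : Prop where
  cofinal : ∀ F : Finset D, ∃ A : Finset D, F ⊆ A ∧ ∀ i, x i • cl A = cl A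
  rich : ∀ A B : Finset D, (A : Set D) ⊆ cl B → (∀ i, x i • cl A = cl A) → ∀ z : Fin n → Γ,
    (∀ i, z i • cl B = cl B) → (∀ i, ∀ d ∈ A, z i • d = x i • d) →
    ∃ k : Γ, (∀ d ∈ A, k • d = d) ∧ ∀ i, ∀ d ∈ B, x i • k • d = k • z i • d

namespace AmpleAction

variable {Γ : Type u} {D : Type v} [Group Γ] [MulAction Γ D] {cl : Set D → Set D}

theorem genericTuple_zero (x : Fin 0 → Γ) : GenericTuple cl x where
  cofinal F := ⟨F, subset_rfl, fun i => i.elim0⟩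
  rich _ _ _ _ _ _ _ := ⟨1, fun d _ => one_smul _ d, fun i => i.elim0⟩

theorem conj_smul_cl (H : AmpleAction Γ cl) {k z : Γ} {s : Set D} (h : z • cl s = cl s) :
    (k * z * k⁻¹) • cl (k • s) = cl (k • s) := by
  rw [← H.smul_cl, smul_smul, inv_mul_cancel_right, ← smul_smul, h]

/-- Cofinality of invariant sets is dense in the last coordinate. -/
theorem cofinal_dense (H : AmpleAction Γ cl) {n : ℕ} {x : Fin n → Γ} (hx : GenericTuple cl x)
    (y₀ : Γ) (F E : Finset D) :
    ∃ (y : Γ) (A : Finset D), F ⊆ A ∧ E ⊆ A ∧ (∀ d ∈ E, y • d = y₀ • d) ∧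
      (∀ i, x i • cl A = cl A) ∧ y • cl A = cl A := by
  classical
  obtain ⟨A, hFA, hA⟩ := hx.cofinal (F ∪ E ∪ E.image (y₀ • ·))
  obtain ⟨N, hAN, h, hh⟩ := H.locallyFinite (n + 1) A (Fin.cons y₀ x)
  simp only [Fin.forall_fin_succ, Fin.cons_zero, Fin.cons_succ] at hh
  -- Local finiteness extends `y₀` and `x` from `A` to automorphisms `h` of `cl N`. Richness finds a
  -- copy `k N` on which `x` itself acts as `h`, and `k h₀ k⁻¹` then supplies the new coordinate. It
  -- agrees with `y₀` on `E` because `A` contains both `E` and `y₀ E`.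
  obtain ⟨k, hkA, hk⟩ := hx.rich A N ((Finset.coe_subset.2 hAN).trans (H.subset_cl _)) hA
    (fun i => h i.succ) (fun i => (hh.2 i).2) (fun i => (hh.2 i).1)
  refine ⟨k * h 0 * k⁻¹, N.image (k • ·), ?_, ?_, ?_, ?_, ?_⟩
  · intro d hd
    have hdA : d ∈ A := hFA (by simp [hd])
    exact Finset.mem_image.2 ⟨d, hAN hdA, hkA d hdA⟩
  · intro d hd
    have hdA : d ∈ A := hFA (by simp [hd])
    exact Finset.mem_image.2 ⟨d, hAN hdA, hkA d hdA⟩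
  · intro d hd
    have hdA : d ∈ A := hFA (by simp [hd])
    have hyA : y₀ • d ∈ A := hFA (Finset.mem_union_right _ (Finset.mem_image_of_mem _ hd))
    have : k⁻¹ • d = d := inv_smul_eq_iff.2 (hkA d hdA).symm
    rw [mul_smul, mul_smul, this, hh.1.1 d hdA, hkA _ hyA]
  · intro i
    have hc : (((N.image (k • ·) : Finset D) : Set D)) = k • (N : Set D) := by simp [Set.image_smul]
    rw [hc]
    have : x i • cl (k • (N : Set D)) = (k * h i.succ * k⁻¹) • cl (k • (N : Set D)) := by
      apply H.smul_cl_congr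
      rintro _ ⟨d, hd, rfl⟩
      simp only [mul_smul, inv_smul_smul]
      exact hk i d hd
    rw [this]
    exact H.conj_smul_cl (hh.2 i).2
  · have hc : (((N.image (k • ·) : Finset D) : Set D)) = k • (N : Set D) := by simp [Set.image_smul]
    rw [hc]
    exact H.conj_smul_cl hh.1.2

/-- Amalgamation: an invariant set `C` containing `E` and an independent copy of `B` over `A` carry
common extensions of the prescribed maps. Richness of `x` realizes the amalgam over `C`, leaving
freedom to choose the last coordinate. -/
theorem rich_dense (H : AmpleAction Γ cl) {n : ℕ} {x : Fin n → Γ} (hx : GenericTuple cl x)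
    {y₀ : Γ} {A B E : Finset D} (hAB : (A : Set D) ⊆ cl B)
    (hA : ∀ i, x i • cl A = cl A) (hyA : y₀ • cl A = cl A)
    {z : Fin n → Γ} {z₀ : Γ} (hz : ∀ i, z i • cl B = cl B) (hz₀ : z₀ • cl B = cl B)
    (hzx : ∀ i, ∀ d ∈ A, z i • d = x i • d) (hzy : ∀ d ∈ A, z₀ • d = y₀ • d) :
    ∃ y k : Γ, (∀ d ∈ E, y • d = y₀ • d) ∧ (∀ d ∈ A, k • d = d) ∧
      (∀ i, ∀ d ∈ B, x i • k • d = k • z i • d) ∧ ∀ d ∈ B, y • k • d = k • z₀ • d := by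
  classical
  obtain ⟨y₁, C, hAC, hEC, hy₁, hC, hyC⟩ := H.cofinal_dense hx y₀ A (A ∪ E)
  have hAC' : (A : Set D) ⊆ cl C := (Finset.coe_subset.2 hAC).trans (H.subset_cl _)
  obtain ⟨k, hkA, hk⟩ := H.extension A C B hAC' hAB
  have hcB : ∀ w : Γ, w • cl B = cl B →
      (k * w * k⁻¹) • cl (k • (B : Set D)) = cl (k • (B : Set D)) := fun w => H.conj_smul_cl
  have hkA' : ∀ d ∈ cl (A : Set D), k • d = d := H.fix_cl k _ hkA
  have hext : ∀ v w : Γ, v • cl A = cl A → v • cl C = cl C → w • cl B = cl B →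
      (∀ d ∈ A, w • d = v • d) →
      ∃ χ : Γ, (∀ d ∈ C, χ • d = v • d) ∧ ∀ d ∈ B, χ • k • d = k • w • d := by
    intro v w hvA hvC hwB hwv
    obtain ⟨χ, h1, h2⟩ := hk v (k * w * k⁻¹) hvA hvC (hcB w hwB) (by
      intro d hd
      have : k⁻¹ • d = d := inv_smul_eq_iff.2 (hkA d hd).symm
      rw [mul_smul, mul_smul, this, hwv d hd, hkA']
      rw [← hvA]
      exact Set.smul_mem_smul_set (H.subset_cl _ hd))
    exact ⟨χ, h1, fun d hd => by rw [h2 d hd, mul_smul, mul_smul, inv_smul_smul]⟩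
  have hy₁A : y₁ • cl A = cl A := by
    exact (H.smul_cl_congr fun d hd =>
      hy₁ d (Finset.mem_union_left _ (Finset.mem_coe.1 hd))).trans hyA
  choose χ hχC hχB using fun i => hext (x i) (z i) (hA i) (hC i) (hz i) (hzx i)
  obtain ⟨χ₀, hχ₀C, hχ₀B⟩ := hext y₁ z₀ hy₁A hyC hz₀ fun d hd => by
    rw [hzy d hd, hy₁ d (by simp [hd])]
  -- The extension property gives `χ` on generators only. Invariance of the closure of `C ∪ k B`
  -- follows from invariance of the closures of the two pieces, applied to `χ` and `χ⁻¹`.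
  have hinv : ∀ v w χ : Γ, v • cl C = cl C → w • cl B = cl B → (∀ d ∈ C, χ • d = v • d) →
      (∀ d ∈ B, χ • k • d = k • w • d) →
      χ • cl ((C ∪ B.image (k • ·) : Finset D) : Set D) =
        cl ((C ∪ B.image (k • ·) : Finset D) : Set D) := by
    intro v w χ hvC hwB h1 h2
    have hCE : cl (C : Set D) ⊆ cl ((C ∪ B.image (k • ·) : Finset D) : Set D) :=
      H.cl_mono (by simp)
    have hBE : cl (k • (B : Set D)) ⊆ cl ((C ∪ B.image (k • ·) : Finset D) : Set D) :=
      H.cl_mono (by simp [← Set.image_smul])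
    have hχC : χ • cl (C : Set D) = cl C := (H.smul_cl_congr h1).trans hvC
    have hχB : χ • cl (k • (B : Set D)) = cl (k • (B : Set D)) := by
      refine (H.smul_cl_congr (h := k * w * k⁻¹) ?_).trans (hcB w hwB)
      rintro _ ⟨d, hd, rfl⟩
      simp only [mul_smul, inv_smul_smul]
      exact h2 d hd
    have key : ∀ χ : Γ, χ • cl (C : Set D) = cl C →
        χ • cl (k • (B : Set D)) = cl (k • (B : Set D)) →
        χ • cl ((C ∪ B.image (k • ·) : Finset D) : Set D) ⊆
        cl ((C ∪ B.image (k • ·) : Finset D) : Set D) := by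
      intro χ h1 h2
      rw [H.smul_cl]
      apply H.cl_subset
      rintro _ ⟨d, hd, rfl⟩
      simp only [Finset.coe_union, Finset.coe_image, Set.image_smul] at hd
      rcases hd with hd | hd
      · exact hCE (h1 ▸ Set.smul_mem_smul_set (H.subset_cl _ hd))
      · exact hBE (h2 ▸ Set.smul_mem_smul_set (H.subset_cl _ hd))
    refine (key χ hχC hχB).antisymm ?_
    rw [Set.subset_smul_set_iff]
    exact key χ⁻¹ (inv_smul_eq_iff.2 hχC.symm) (inv_smul_eq_iff.2 hχB.symm)
  obtain ⟨l, hlC, hl⟩ := hx.rich C (C ∪ B.image (k • ·))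
    ((Finset.coe_subset.2 Finset.subset_union_left).trans (H.subset_cl _)) hC χ
    (fun i => hinv (x i) (z i) (χ i) (hC i) (hz i) (hχC i) (hχB i)) hχC
  refine ⟨l * χ₀ * l⁻¹, l * k, ?_, ?_, ?_, ?_⟩
  · intro d hd
    have hdC : d ∈ C := hEC (by simp [hd])
    have h1 : l⁻¹ • d = d := inv_smul_eq_iff.2 (hlC d hdC).symm
    rw [mul_smul, mul_smul, h1, hχ₀C d hdC, ← hy₁ d (by simp [hd])]
    refine H.fix_cl l _ hlC _ ?_
    rw [← hyC]
    exact Set.smul_mem_smul_set (H.subset_cl _ hdC)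
  · intro d hd
    rw [mul_smul, hkA d hd, hlC d (hAC hd)]
  · intro i d hd
    have := hl i (k • d) (Finset.mem_union_right _ (Finset.mem_image_of_mem _ hd))
    rw [mul_smul, this, hχB i d hd, mul_smul]
  · intro d hd
    simp only [mul_smul, inv_smul_smul]
    rw [hχ₀B d hd]

/-- Genericity of the longer tuple is a countable intersection of dense open conditions: density is
`cofinal_dense` and `rich_dense`, and countability comes from testing richness only on a countable
dense set `Q` of extensions. -/
theorem genericTuple_cons_residual [Countable D] (H : AmpleAction Γ cl) {n : ℕ} {x : Fin n → Γ}
    (hx : GenericTuple cl x) :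
    {y | GenericTuple cl (Fin.cons y x : Fin (n + 1) → Γ)} ∈
      @residual Γ (discretePointwise Γ D) := by
  classical
  let _ := discretePointwise Γ D
  obtain ⟨Q, hQc, hQ⟩ := exists_countable_dense_elements Γ D
  have := hQc.to_subtype
  have h1 : ⋂ F : Finset D, {y : Γ | ∃ A : Finset D, F ⊆ A ∧ (∀ i, x i • cl A = cl A) ∧
      y • cl A = cl A} ∈ residual Γ := by
    refine countable_iInter_mem.2 fun F => residual_of_dense_open ?_ ?_
    · rintro y ⟨A, hF, hA, hy⟩
      exact ⟨A, fun y' hy' => ⟨A, hF, hA, (H.smul_cl_congr hy').trans hy⟩⟩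
    · rw [dense_iff (D := D)]
      intro y₀ E
      obtain ⟨y, A, h1, h2, h3, h4, h5⟩ := H.cofinal_dense hx y₀ F E
      exact ⟨y, ⟨A, h1, h4, h5⟩, h3⟩
  let P : Finset D × Finset D × (Fin (n + 1) → Q) → Γ → Prop := fun q y =>
    (q.1 : Set D) ⊆ cl q.2.1 → (∀ i, x i • cl q.1 = cl q.1) → y • cl q.1 = cl q.1 →
    (∀ i, (q.2.2 i : Γ) • cl q.2.1 = cl q.2.1) →
    (∀ i : Fin n, ∀ d ∈ q.1, (q.2.2 i.succ : Γ) • d = x i • d) →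
    (∀ d ∈ q.1, (q.2.2 0 : Γ) • d = y • d) →
    ∃ k : Γ, (∀ d ∈ q.1, k • d = d) ∧
      (∀ i : Fin n, ∀ d ∈ q.2.1, x i • k • d = k • (q.2.2 i.succ : Γ) • d) ∧
      ∀ d ∈ q.2.1, y • k • d = k • (q.2.2 0 : Γ) • d
  have h2 : ⋂ q, {y : Γ | P q y} ∈ residual Γ := by
    refine countable_iInter_mem.2 fun q => residual_of_dense_open ?_ ?_
    -- Open in either case: a witness `k` survives changes of `y` off `k B`, and if there is none
    -- then a hypothesis depending only on `y` restricted to `A` must fail.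
    · intro y hy
      by_cases hc : ∃ k : Γ, (∀ d ∈ q.1, k • d = d) ∧
        (∀ i : Fin n, ∀ d ∈ q.2.1, x i • k • d = k • (q.2.2 i.succ : Γ) • d) ∧
        ∀ d ∈ q.2.1, y • k • d = k • (q.2.2 0 : Γ) • d
      · obtain ⟨k, hk1, hk2, hk3⟩ := hc
        refine ⟨q.2.1.image (k • ·), fun y' hy' _ _ _ _ _ _ => ⟨k, hk1, hk2, fun d hd => ?_⟩⟩
        rw [hy' _ (Finset.mem_image_of_mem _ hd), hk3 d hd]
      · refine ⟨q.1, fun y' hy' a1 a2 a3 a4 a5 a6 => absurd ?_ hc⟩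
        exact hy a1 a2 ((H.smul_cl_congr hy').symm.trans a3) a4 a5
          fun d hd => (a6 d hd).trans (hy' d hd)
    · rw [dense_iff (D := D)]
      intro y₀ E
      by_cases hc : P q y₀
      · exact ⟨y₀, hc, fun _ _ => rfl⟩
      · simp only [P, Classical.not_imp] at hc
        obtain ⟨a1, a2, a3, a4, a5, a6, -⟩ := hc
        obtain ⟨y, k, h1, h2, h3, h4⟩ := H.rich_dense hx (E := E) a1 a2 a3
          (fun i => a4 (Fin.succ i)) (a4 0) a5 a6
        exact ⟨y, fun _ _ _ _ _ _ => ⟨k, h2, h3, h4⟩, h1⟩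
  filter_upwards [h1, h2] with y hy1 hy2
  refine ⟨fun F => ?_, fun A B hAB hA z hz hzA => ?_⟩
  · obtain ⟨A, h1, h2, h3⟩ := Set.mem_iInter.1 hy1 F
    exact ⟨A, h1, by simpa [Fin.forall_fin_succ] using ⟨h3, h2⟩⟩
  -- Only the values of `z` on `A ∪ B` matter, so `z` may be replaced by members of `Q`.
  · choose q hqQ hq using fun i => hQ (z i) (A ∪ B)
    simp only [Fin.forall_fin_succ, Fin.cons_zero, Fin.cons_succ] at hA hzA ⊢
    obtain ⟨k, hk1, hk2, hk3⟩ := Set.mem_iInter.1 hy2 (A, B, fun i => ⟨q i, hqQ i⟩) hAB hA.2 hA.1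
      (fun i => (H.smul_cl_congr fun d hd => hq i d (Finset.mem_union_right _ hd)).trans (hz i))
      (fun i d hd => (hq _ d (Finset.mem_union_left _ hd)).trans (hzA.2 i d hd))
      (fun d hd => (hq _ d (Finset.mem_union_left _ hd)).trans (hzA.1 d hd))
    refine ⟨k, hk1, fun d hd => ?_, fun i d hd => ?_⟩
    · rw [hk3 d hd, hq 0 d (Finset.mem_union_right _ hd)]
    · rw [hk2 i d hd, hq i.succ d (Finset.mem_union_right _ hd)]

/-- One extension step of the back-and-forth between generic tuples. -/
theorem generic_forth (H : AmpleAction Γ cl) {n : ℕ} {x x' : Fin n → Γ} (hx : GenericTuple cl x)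
    (hx' : GenericTuple cl x') {A : Finset D} {f : Γ} (hA : ∀ i, x i • cl A = cl A)
    (hf : ∀ i, ∀ d ∈ A, f • x i • d = x' i • f • d) (E : Finset D) :
    ∃ (B : Finset D) (f' : Γ), A ⊆ B ∧ E ⊆ B ∧ (∀ d ∈ A, f' • d = f • d) ∧
      (∀ i, x i • cl B = cl B) ∧ ∀ i, ∀ d ∈ B, f' • x i • d = x' i • f' • d := by
  classical
  obtain ⟨B, hB, hBi⟩ := hx.cofinal (A ∪ E)
  have hc : ∀ C : Finset D, ((C.image (f • ·) : Finset D) : Set D) = f • (C : Set D) := fun C => by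
    simp [Set.image_smul]
  -- Transport the action of `x` on `B` along `f`. It extends the action of `x'` on `f A`, so
  -- richness of `x'` realizes it via some `k` fixing `f A`, and the new map is `k f`.
  obtain ⟨k, hk1, hk2⟩ := hx'.rich (A.image (f • ·)) (B.image (f • ·)) (by
      refine (Finset.coe_subset.2 (Finset.image_subset_image ?_)).trans (H.subset_cl _)
      exact Finset.subset_union_left.trans hB) (by
      intro i
      rw [hc]
      refine (H.smul_cl_congr (h := f * x i * f⁻¹) ?_).trans (H.conj_smul_cl (hA i))
      rintro _ ⟨d, hd, rfl⟩
      simp only [mul_smul, inv_smul_smul]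
      exact (hf i d hd).symm) (fun i => f * x i * f⁻¹) (by
      intro i
      rw [hc]
      exact H.conj_smul_cl (hBi i)) (by
      intro i d hd
      obtain ⟨d, hd', rfl⟩ := Finset.mem_image.1 hd
      simp only [mul_smul, inv_smul_smul]
      exact hf i d hd')
  refine ⟨B, k * f, Finset.subset_union_left.trans hB, Finset.subset_union_right.trans hB,
    fun d hd => ?_, hBi, fun i d hd => ?_⟩
  · rw [mul_smul, hk1 _ (Finset.mem_image_of_mem _ hd)]
  · have := hk2 i _ (Finset.mem_image_of_mem _ hd)
    simp only [mul_smul, inv_smul_smul] at this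
    simp only [mul_smul, this]

/-- Generic tuples which agree on a common invariant set are conjugate over it. -/
theorem generic_conj [Countable D] [FaithfulSMul Γ D] (H : AmpleAction Γ cl) {n : ℕ}
    {x x' : Fin n → Γ} (hx : GenericTuple cl x) (hx' : GenericTuple cl x') {A : Finset D}
    (hA : ∀ i, x i • cl A = cl A) (hxx' : ∀ i, ∀ d ∈ A, x i • d = x' i • d) :
    ∃ f : Γ, (∀ d ∈ A, f • d = d) ∧ ∀ i, f * x i = x' i * f := by
  classical
  obtain ⟨g, f, B, hf0, hB0, hP, hmono, hex, hg⟩ := H.exists_limit_of_step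
    (fun _ f B => (∀ i, x i • cl B = cl B) ∧ ∀ i, ∀ d ∈ B, f • x i • d = x' i • f • d)
    (g₀ := 1) (A₀ := A) ⟨hA, fun i d hd => by simpa using hxx' i d hd⟩ (by
      rintro - f B E ⟨hB, hf⟩
      obtain ⟨C, f₁, hBC, hEC, hf₁, hC, hf₁x⟩ := H.generic_forth hx hx' hB hf E
      have hc : ((C.image (f₁ • ·) : Finset D) : Set D) = f₁ • (C : Set D) := by
        simp [Set.image_smul]
      -- The back step is the forth step for the inverse `f₁⁻¹`, with the roles of `x` and `x'`
      -- exchanged. The resulting map `e` is then inverted.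
      obtain ⟨G, e, hCG, hEG, he, hG, hex⟩ := H.generic_forth hx' hx
        (A := C.image (f₁ • ·)) (f := f₁⁻¹) (by
          intro i
          rw [hc]
          refine (H.smul_cl_congr (h := f₁ * x i * f₁⁻¹) ?_).trans (H.conj_smul_cl (hC i))
          rintro _ ⟨d, hd, rfl⟩
          simp only [mul_smul, inv_smul_smul]
          exact (hf₁x i d hd).symm) (by
          intro i d hd
          obtain ⟨d, hd', rfl⟩ := Finset.mem_image.1 hd
          simp only [inv_smul_smul, ← hf₁x i d hd']) E
      have heC : ∀ d ∈ C, e⁻¹ • d = f₁ • d := fun d hd => by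
        have := he _ (Finset.mem_image_of_mem _ hd)
        rw [inv_smul_smul] at this
        rw [inv_smul_eq_iff, this]
      have hCe : C ⊆ G.image (e • ·) := fun d hd => by
        refine Finset.mem_image.2 ⟨f₁ • d, hCG (Finset.mem_image_of_mem _ hd), ?_⟩
        rw [← heC d hd, smul_inv_smul]
      refine ⟨e⁻¹, G.image (e • ·), ⟨fun i => ?_, fun i d hd => ?_⟩, hBC.trans hCe,
        fun d hd => (heC d (hBC hd)).trans (hf₁ d hd), fun d hd => ⟨hCe (hEC hd), ?_⟩⟩
      · have : ((G.image (e • ·) : Finset D) : Set D) = e • (G : Set D) := by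
          simp [Set.image_smul]
        rw [this]
        refine (H.smul_cl_congr (h := e * x' i * e⁻¹) ?_).trans (H.conj_smul_cl (hG i))
        rintro _ ⟨d, hd, rfl⟩
        simp only [mul_smul, inv_smul_smul]
        exact (hex i d hd).symm
      · obtain ⟨d, hd', rfl⟩ := Finset.mem_image.1 hd
        simp only [← hex i d hd', inv_smul_smul]
      · rw [inv_inv]
        exact Finset.mem_image_of_mem _ (hEG hd))
  refine ⟨g, fun d hd => ?_, fun i => FaithfulSMul.eq_of_smul_eq_smul (α := D) fun d => ?_⟩
  · rw [hg 0 d (hB0 ▸ hd), hf0, one_smul]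
  · obtain ⟨a, ha⟩ := hex d
    obtain ⟨b, hb⟩ := hex (x i • d)
    have ha' := hmono (le_max_left a b) ha
    have hb' := hmono (le_max_right a b) hb
    rw [mul_smul, mul_smul, hg _ _ hb', hg _ _ ha', (hP (max a b)).2 i d ha']

end AmpleAction

-- Nonmeager translates, the tree of conjugators and the eighth power

namespace AmpleAction

variable {Γ : Type u} {D : Type v} [Group Γ] [MulAction Γ D] {cl : Set D → Set D}

/-- Replace `w` by `w y` for some `y` fixing `F` with `w y ∈ W`; translation by `y` preserves the
condition. Having `w` in `W` itself is what lets `w` and `w⁻¹` count as single factors later. -/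
theorem exists_mem_everywhere_nonmeager [Countable D] (H : AmpleAction Γ cl) {W : Set Γ}
    {k : ℕ → Γ} (hk : ⋃ n, k n • W = Set.univ) :
    ∃ w ∈ W, ∃ F : Finset D, ∀ R ∈ @residual Γ (discretePointwise Γ D), ∀ v : Γ,
      (∀ d ∈ F, v • d = d) → ∀ E : Finset D, ∃ y ∈ R, w * y ∈ W ∧ ∀ d ∈ E, y • d = v • d := by
  obtain ⟨w, F, hw⟩ := H.exists_everywhere_nonmeager hk
  obtain ⟨y, -, hyW, hy⟩ := hw Set.univ Filter.univ_mem 1 (fun d _ => one_smul _ d) F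
  refine ⟨w * y, hyW, F, fun R hR v hv E => ?_⟩
  obtain ⟨z, hzR, hzW, hz⟩ := hw _ (residual_translate hR y⁻¹) (y * v)
    (fun d hd => by rw [mul_smul, hv d hd, hy d hd, one_smul]) E
  refine ⟨y⁻¹ * z, hzR, by simpa [mul_assoc] using hzW, fun d hd => ?_⟩
  rw [mul_smul, hz d hd, mul_smul, inv_smul_smul]

/-- A node of the tree of conjugating elements: a generic tuple, a group element and a finite set
on which the element is final. -/
structure ConjNode (Γ : Type u) {D : Type v} [Group Γ] [MulAction Γ D] (cl : Set D → Set D) where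
  len : ℕ
  tuple : Fin len → Γ
  elt : Γ
  dom : Finset D
  generic : GenericTuple cl tuple

/-- Adjoin to the generic tuple either `y₀ ∈ P` or a `y₁ ∈ Q` agreeing with `y₀` on a large
invariant set. The two longer tuples are conjugate by an `f` fixing that set and commuting with the
old tuple, and `f⁻¹` corrects the group element of the right child. -/
theorem exists_conjNode_step [Countable D] [FaithfulSMul Γ D] (H : AmpleAction Γ cl)
    {P Q : Set Γ} {F : Finset D}
    (hP : ∀ R ∈ @residual Γ (discretePointwise Γ D), ∃ y ∈ R, y ∈ P ∧ ∀ d ∈ F, y • d = d)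
    (hQ : ∀ R ∈ @residual Γ (discretePointwise Γ D), ∀ v : Γ, (∀ d ∈ F, v • d = d) →
      ∀ E : Finset D, ∃ y ∈ R, y ∈ Q ∧ ∀ d ∈ E, y • d = v • d)
    (q : ConjNode Γ cl) (E : Finset D) : ∃ (q' : Bool → ConjNode Γ cl) (y : Bool → Γ),
      y false ∈ P ∧ y true ∈ Q ∧ ∀ b, y b ∈ Set.range (q' b).tuple ∧
        (q' b).elt * y b * (q' b).elt⁻¹ = q.elt * y false * q.elt⁻¹ ∧
        Set.range q.tuple ⊆ Set.range (q' b).tuple ∧ q.dom ⊆ (q' b).dom ∧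
        (∀ d ∈ q.dom, (q' b).elt • d = q.elt • d) ∧
        (∀ d ∈ E, d ∈ (q' b).dom ∧ (q' b).elt⁻¹ • d ∈ (q' b).dom) ∧
        ∀ c ∈ Set.range q.tuple, (q' b).elt * c * (q' b).elt⁻¹ = q.elt * c * q.elt⁻¹ := by
  classical
  have hres := H.genericTuple_cons_residual q.generic
  obtain ⟨y₀, hy₀, hy₀P, hy₀F⟩ := hP _ hres
  -- The preimages of `E` are included so that the inverse of the group element is also frozen on
  -- `E`.
  let E' := q.dom ∪ E ∪ E.image (q.elt⁻¹ • ·)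
  obtain ⟨A, hA, hAi⟩ := hy₀.cofinal E'
  obtain ⟨y₁, hy₁, hy₁Q, hy₁A⟩ := hQ _ hres y₀ hy₀F A
  obtain ⟨f, hfA, hf⟩ := H.generic_conj hy₀ hy₁ hAi (by
    simp only [Fin.forall_fin_succ, Fin.cons_zero, Fin.cons_succ]
    exact ⟨fun d hd => (hy₁A d hd).symm, fun _ _ _ => by trivial⟩)
  simp only [Fin.forall_fin_succ, Fin.cons_zero, Fin.cons_succ] at hf
  have hfE : ∀ d ∈ E', f • d = d := fun d hd => hfA d (hA hd)
  have hfE' : ∀ d ∈ E', f⁻¹ • d = d := fun d hd => inv_smul_eq_iff.2 (hfE d hd).symm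
  have hr : ∀ y, Set.range q.tuple ⊆ Set.range (Fin.cons y q.tuple : Fin (q.len + 1) → Γ) := by
    rintro y _ ⟨i, rfl⟩
    exact ⟨i.succ, by simp⟩
  -- Since `f⁻¹ y₁ f = y₀`, the element `q.elt * f⁻¹` conjugates `y₁` to the same element as `q.elt`
  -- conjugates `y₀`; earlier tuple entries commute with `f`, so their conjugates do not change.
  refine ⟨fun b => bif b then ⟨q.len + 1, Fin.cons y₁ q.tuple, q.elt * f⁻¹, E', hy₁⟩
    else ⟨q.len + 1, Fin.cons y₀ q.tuple, q.elt, E', hy₀⟩, fun b => bif b then y₁ else y₀,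
    hy₀P, hy₁Q, ?_⟩
  rintro (_ | _)
  · refine ⟨⟨(0 : Fin (q.len + 1)), rfl⟩, rfl, hr _, fun d hd => by simp [E', hd],
      fun _ _ => rfl, fun d hd => ?_,
      fun _ _ => rfl⟩
    exact ⟨by simp [E', hd], Finset.mem_union_right _ (Finset.mem_image_of_mem _ hd)⟩
  · refine ⟨⟨(0 : Fin (q.len + 1)), rfl⟩, ?_, hr _, fun d hd => by simp [E', hd],
      fun d hd => ?_, fun d hd => ?_, ?_⟩
    · have : f⁻¹ * y₁ * f = y₀ := by rw [mul_assoc, ← hf.1, inv_mul_cancel_left]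
      simp only [cond_true, cond_false, mul_inv_rev, inv_inv, ← this]
      group
    · simp only [cond_true, mul_smul]
      rw [hfE' d (by simp [E', hd])]
    · have hm : q.elt⁻¹ • d ∈ E' := Finset.mem_union_right _ (Finset.mem_image_of_mem _ hd)
      refine ⟨by simp [E', hd], ?_⟩
      simp only [cond_true, mul_inv_rev, inv_inv, mul_smul]
      rwa [hfE _ hm]
    · rintro _ ⟨i, rfl⟩
      have : f⁻¹ * q.tuple i * f = q.tuple i := by
        rw [mul_assoc, ← hf.2 i, inv_mul_cancel_left]
      simp only [cond_true, mul_inv_rev, inv_inv]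
      calc q.elt * f⁻¹ * q.tuple i * (f * q.elt⁻¹) = q.elt * (f⁻¹ * q.tuple i * f) * q.elt⁻¹ := by
            group
        _ = _ := by rw [this]

/-- There is a Cantor scheme of group elements such that two elements which branch at some point
conjugate an element of `P` and an element of `Q` to the same element. -/
theorem exists_conj_tree [Countable D] [FaithfulSMul Γ D] (H : AmpleAction Γ cl)
    {P Q : Set Γ} {F : Finset D}
    (hP : ∀ R ∈ @residual Γ (discretePointwise Γ D), ∃ y ∈ R, y ∈ P ∧ ∀ d ∈ F, y • d = d)
    (hQ : ∀ R ∈ @residual Γ (discretePointwise Γ D), ∀ v : Γ, (∀ d ∈ F, v • d = d) →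
      ∀ E : Finset D, ∃ y ∈ R, y ∈ Q ∧ ∀ d ∈ E, y • d = v • d) :
    ∃ h : (ℕ → Bool) → Γ, ∀ α β n, (∀ i < n, α i = β i) → α n = false → β n = true →
      ∃ y ∈ P, ∃ z ∈ Q, h α * y * (h α)⁻¹ = h β * z * (h β)⁻¹ := by
  classical
  obtain ⟨e⟩ := nonempty_encodable D
  choose q' y hyP hyQ hr hconj hran hdom helt hE hcomm using H.exists_conjNode_step hP hQ
  let E : ℕ → Finset D := fun n => (Encodable.decode n : Option D).toFinset
  let st : (ℕ → Bool) → ℕ → ConjNode Γ cl := fun α n =>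
    Nat.rec ⟨0, Fin.elim0, 1, ∅, genericTuple_zero _⟩ (fun n q => q' q (E n) (α n)) n
  have hst : ∀ α n, st α (n + 1) = q' (st α n) (E n) (α n) := fun _ _ => rfl
  have hmem : ∀ α d, d ∈ (st α (Encodable.encode d + 1)).dom ∧
      (st α (Encodable.encode d + 1)).elt⁻¹ • d ∈ (st α (Encodable.encode d + 1)).dom :=
    fun α d => hE (st α (Encodable.encode d)) (E (Encodable.encode d)) _ d (by simp [E])
  have hsub : ∀ α n, (st α n).dom ⊆ (st α (n + 1)).dom := fun α n => hdom _ _ _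
  choose h hh using fun α => H.exists_limit (fun n => (st α n).elt) (fun n => (st α n).dom)
    (hsub α) (fun n => helt _ _ _) (fun d => ⟨Encodable.encode d + 1, (hmem α d).1⟩)
    (fun d => ⟨Encodable.encode d + 1, (hmem α d).2⟩)
  -- Once `c` is in the tuple, later steps never change its conjugate by the current group element,
  -- so the limit `h α` conjugates it in the same way.
  have hlim : ∀ α n, ∀ c ∈ Set.range (st α n).tuple,
      h α * c * (h α)⁻¹ = (st α n).elt * c * (st α n).elt⁻¹ := by
    intro α n c hc
    have key : ∀ m, n ≤ m → c ∈ Set.range (st α m).tuple ∧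
        (st α m).elt * c * (st α m).elt⁻¹ = (st α n).elt * c * (st α n).elt⁻¹ := by
      intro m hm
      induction m, hm using Nat.le_induction with
      | base => exact ⟨hc, rfl⟩
      | succ m _ ih => exact ⟨hran _ _ _ ih.1, (hcomm _ _ _ c ih.1).trans ih.2⟩
    rw [mul_inv_eq_iff_eq_mul]
    refine FaithfulSMul.eq_of_smul_eq_smul (α := D) fun d => ?_
    have mono : Monotone fun n => (st α n).dom := monotone_nat_of_le_succ (hsub α)
    let m := max n (max (Encodable.encode d + 1) (Encodable.encode (c • d) + 1))
    have h1 : d ∈ (st α m).dom :=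
      mono ((le_max_left _ _).trans (le_max_right _ _)) (hmem α d).1
    have h2 : c • d ∈ (st α m).dom :=
      mono ((le_max_right _ _).trans (le_max_right _ _)) (hmem α (c • d)).1
    rw [mul_smul, mul_smul _ (h α), hh α m _ h2, hh α m _ h1, ← (key m (le_max_left _ _)).2]
    simp [mul_smul]
  refine ⟨h, fun α β n hαβ hα hβ => ?_⟩
  -- The node at level `j` depends only on the first `j` bits, so the two branches share the node at
  -- which they split.
  have hn : ∀ j ≤ n, st α j = st β j := by
    intro j
    induction j with
    | zero => intro _; rfl
    | succ j ih => intro hj; rw [hst, hst, ih (by omega), hαβ j hj]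
  refine ⟨y (st α n) (E n) false, hyP _ _, y (st α n) (E n) true, hyQ _ _, ?_⟩
  have hα' : st α (n + 1) = q' (st α n) (E n) false := by rw [hst, hα]
  have hβ' : st β (n + 1) = q' (st α n) (E n) true := by rw [hst, hβ, hn n le_rfl]
  rw [hlim α (n + 1) _ (hα' ▸ hr _ _ false), hlim β (n + 1) _ (hβ' ▸ hr _ _ true), hα', hβ',
    hconj, hconj]

/-- Apply the tree to `P = w⁻¹ W` and `Q = g w⁻¹ W`; the latter is still nonmeager near the
stabilizer of `F` because `g` fixes `F`. Two branches falling in the same translate of `W` express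
`g` through eight elements of `W`. -/
theorem exists_stabilizer_subset_pow [Countable D] [FaithfulSMul Γ D] (H : AmpleAction Γ cl)
    {W : Set Γ} (hW : W⁻¹ = W) {k : ℕ → Γ} (hk : ⋃ n, k n • W = Set.univ) :
    ∃ F : Finset D, ∀ g : Γ, (∀ d ∈ F, g • d = d) → g ∈ W ^ 8 := by
  classical
  obtain ⟨w, hw, F, hF⟩ := H.exists_mem_everywhere_nonmeager hk
  refine ⟨F, fun g hg => ?_⟩
  obtain ⟨h, hh⟩ := H.exists_conj_tree (F := F) (P := {y | w * y ∈ W})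
    (Q := {y | w * (g⁻¹ * y) ∈ W}) (by
      intro R hR
      obtain ⟨y, h1, h2, h3⟩ := hF R hR 1 (fun d _ => one_smul _ d) F
      exact ⟨y, h1, h2, fun d hd => by rw [h3 d hd, one_smul]⟩) (by
      intro R hR v hv E
      obtain ⟨y, h1, h2, h3⟩ := hF _ (residual_translate hR g) (g⁻¹ * v) (fun d hd => by
        rw [mul_smul, hv d hd, inv_smul_eq_iff, hg d hd]) E
      refine ⟨g * y, h1, by simpa using h2, fun d hd => ?_⟩
      rw [mul_smul, h3 d hd, mul_smul, smul_inv_smul])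
  have hmem : ∀ α, ∃ n, (k n)⁻¹ * h α ∈ W := fun α => by
    obtain ⟨n, hn⟩ := Set.mem_iUnion.1 (hk.symm ▸ Set.mem_univ (h α) : h α ∈ ⋃ n, k n • W)
    exact ⟨n, by simpa [Set.mem_smul_set_iff_inv_smul_mem] using hn⟩
  choose m hm using hmem
  -- Cantor: there is no injection from subsets of `ℕ` into `ℕ`.
  obtain ⟨α, β, hαβ, hne⟩ : ∃ α β, m α = m β ∧ α ≠ β := by
    by_contra! hcon
    refine Function.cantor_injective (fun s : Set ℕ => m fun n => decide (n ∈ s)) ?_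
    intro s t hst
    ext n
    simpa using congrFun (hcon _ _ hst) n
  have hex : ∃ n, α n ≠ β n := Function.ne_iff.1 hne
  obtain ⟨α, β, n, hlt, hα, hβ, hαβ⟩ : ∃ α β n, (∀ i < n, α i = β i) ∧ α n = false ∧ β n = true ∧
      m α = m β := by
    have hlt : ∀ i < Nat.find hex, α i = β i := fun i hi => not_not.1 (Nat.find_min hex hi)
    have hspec := Nat.find_spec hex
    cases hα : α (Nat.find hex)
    · exact ⟨α, β, _, hlt, hα, by simpa [hα] using hspec.symm, hαβ⟩
    · exact ⟨β, α, _, fun i hi => (hlt i hi).symm, by simpa [hα] using hspec.symm, hα, hαβ.symm⟩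
  obtain ⟨y, hy, z, hz, hyz⟩ := hh α β n hlt hα hβ
  have inv : ∀ {x}, x ∈ W → x⁻¹ ∈ W := fun {x} hx => by
    rw [← hW]; simpa using hx
  have h1 := hm α
  have h2 := hm β
  rw [hαβ] at h1
  set a := (k (m β))⁻¹ * h α
  set b := (k (m β))⁻¹ * h β
  have hab : a * y * a⁻¹ = b * z * b⁻¹ := by
    have : ∀ x s : Γ, (k (m β))⁻¹ * x * s * ((k (m β))⁻¹ * x)⁻¹ =
      (k (m β))⁻¹ * (x * s * x⁻¹) * k (m β) := fun x s => by group
    simp only [a, b, this, hyz]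
  have hz' : z = b⁻¹ * (a * y * a⁻¹) * b := by rw [hab]; group
  -- The common translation cancels, so `z` is the conjugate of `y` by `b⁻¹ a` with `a, b ∈ W`.
  -- Writing `g = z (g⁻¹ z)⁻¹` exhibits the eight factors.
  have hg' : g = b⁻¹ * a * w⁻¹ * (w * y) * a⁻¹ * b * (w * (g⁻¹ * z))⁻¹ * w := by
    have : g = b⁻¹ * (a * y * a⁻¹) * b * z⁻¹ * g := by rw [← hz']; group
    conv_lhs => rw [this]
    group
  have h8 : W ^ 8 = W * W * W * W * W * W * W * W := by simp only [pow_succ, pow_zero, one_mul]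
  rw [hg', h8]
  exact Set.mul_mem_mul (Set.mul_mem_mul (Set.mul_mem_mul (Set.mul_mem_mul (Set.mul_mem_mul
    (Set.mul_mem_mul (Set.mul_mem_mul (inv h2) h1) (inv hw)) hy) (inv h1)) h2) (inv hz)) hw

end AmpleAction

namespace MetricStructure

variable {L : MetricSignature} {X : Type u} [MetricSpace X]

/-! ### The action of the automorphism group -/

instance autMulAction (M : MetricStructure L X) : MulAction M.aut X where
  smul g x := g.1 x
  one_smul _ := rfl
  mul_smul _ _ _ := rfl

theorem aut_smul_def {M : MetricStructure L X} (g : M.aut) (x : X) : g • x = g.1 x := rfl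

instance aut_isIsometricSMul (M : MetricStructure L X) : IsIsometricSMul M.aut X :=
  ⟨fun g => g.1.isometry⟩

instance aut_faithfulSMul (M : MetricStructure L X) : FaithfulSMul M.aut X :=
  ⟨fun h => Subtype.ext (IsometryEquiv.ext h)⟩

theorem funPt_smul {M : MetricStructure L X} (g : M.aut) (f : L.Func) (x r i) :
    M.funPt f (fun j => g • x j) r i = g • M.funPt f x r i := g.2.1 f x r i

theorem funReal_smul {M : MetricStructure L X} (g : M.aut) (f : L.Func) (x r i) :
    M.funReal f (fun j => g • x j) r i = M.funReal f x r i := g.2.2.1 f x r i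

theorem rel_smul {M : MetricStructure L X} (g : M.aut) (R : L.Rel) (x r) :
    M.rel R (fun j => g • x j) r ↔ M.rel R x r := g.2.2.2 R x r

/-! ### Generated substructures -/

theorem gen_induction {M : MetricStructure L X} {F : Set X} {P : X → Prop} {Q : ℝ → Prop}
    (hbasic : ∀ x ∈ F, P x)
    (hfun : ∀ f x r i, (∀ j, P (x j)) → (∀ j, Q (r j)) → P (M.funPt f x r i))
    (hdist : ∀ x y, P x → P y → Q (dist x y))
    (hreal : ∀ f x r i, (∀ j, P (x j)) → (∀ j, Q (r j)) → Q (M.funReal f x r i)) :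
    (∀ x ∈ M.gen F, P x) ∧ ∀ r, M.GenReal F r → Q r :=
  ⟨fun _ hx => GenPt.rec (motive_1 := fun x _ => P x) (motive_2 := fun r _ => Q r) hbasic
    (fun f x r i _ _ => hfun f x r i) (fun x y _ _ => hdist x y)
    (fun f x r i _ _ => hreal f x r i) hx,
  fun _ hr => GenReal.rec (motive_1 := fun x _ => P x) (motive_2 := fun r _ => Q r) hbasic
    (fun f x r i _ _ => hfun f x r i) (fun x y _ _ => hdist x y)
    (fun f x r i _ _ => hreal f x r i) hr⟩

theorem subset_gen (M : MetricStructure L X) (F : Set X) : F ⊆ M.gen F := GenPt.basic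

theorem gen_subset_and {M : MetricStructure L X} {F G : Set X} (h : F ⊆ M.gen G) :
    (∀ x ∈ M.gen F, x ∈ M.gen G) ∧ ∀ r, M.GenReal F r → M.GenReal G r :=
  gen_induction h (fun f x r i hx hr => GenPt.func f x r i hx hr)
    (fun _ _ hx hy => GenReal.dist _ _ hx hy) (fun f x r i hx hr => GenReal.func f x r i hx hr)

theorem gen_subset {M : MetricStructure L X} {F G : Set X} (h : F ⊆ M.gen G) :
    M.gen F ⊆ M.gen G := (gen_subset_and h).1

theorem gen_mono {M : MetricStructure L X} {F G : Set X} (h : F ⊆ G) : M.gen F ⊆ M.gen G :=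
  gen_subset (h.trans (M.subset_gen G))

theorem smul_gen_subset {M : MetricStructure L X} (g : M.aut) (F : Set X) :
    g • M.gen F ⊆ M.gen (g • F) := by
  have := (gen_induction (M := M) (F := F) (P := fun x => g • x ∈ M.gen (g • F))
    (Q := fun r => M.GenReal (g • F) r)
    (fun x hx => M.subset_gen _ (Set.smul_mem_smul_set hx))
    (fun f x r i hx hr => by rw [← funPt_smul]; exact GenPt.func f _ r i hx hr)
    (fun x y hx hy => by rw [← dist_smul g]; exact GenReal.dist _ _ hx hy)
    (fun f x r i hx hr => by rw [← funReal_smul g]; exact GenReal.func f _ r i hx hr)).1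
  rintro _ ⟨x, hx, rfl⟩
  exact this x hx

theorem smul_gen {M : MetricStructure L X} (g : M.aut) (F : Set X) :
    g • M.gen F = M.gen (g • F) := by
  refine (smul_gen_subset g F).antisymm ?_
  rw [Set.subset_smul_set_iff]
  simpa using smul_gen_subset g⁻¹ (g • F)

theorem fix_gen {M : MetricStructure L X} (g : M.aut) (F : Set X) (h : ∀ x ∈ F, g • x = x) :
    ∀ x ∈ M.gen F, g • x = x :=
  (gen_induction (Q := fun _ => True) h (fun f x r i hx _ => by
    rw [← funPt_smul]; congr 1; exact funext hx) (fun _ _ _ _ => trivial)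
    (fun _ _ _ _ _ _ => trivial)).1

theorem isFG_gen (M : MetricStructure L X) {F : Set X} (h : F.Finite) : M.IsFG (M.gen F) :=
  ⟨F, h, rfl⟩

/-! ### Terms and types -/

theorem term_induction {V : Type v} {P : PtTerm L V → Prop} {Q : RealTerm L V → Prop}
    (hvar : ∀ x, P (.var x))
    (hfun : ∀ f s t i, (∀ j, P (s j)) → (∀ j, Q (t j)) → P (.func f s t i))
    (hconst : ∀ r, Q (.const r)) (hdist : ∀ s t, P s → P t → Q (.dist s t))
    (hreal : ∀ f s t i, (∀ j, P (s j)) → (∀ j, Q (t j)) → Q (.func f s t i)) :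
    (∀ t, P t) ∧ ∀ t, Q t :=
  ⟨fun t => PtTerm.rec (motive_1 := P) (motive_2 := Q) hvar hfun hconst hdist hreal t,
    fun t => RealTerm.rec (motive_1 := P) (motive_2 := Q) hvar hfun hconst hdist hreal t⟩

theorem eval_func {M : MetricStructure L X} {V : Type v} (b : V → X) (f : L.Func) (s t i) :
    (PtTerm.func f s t i).eval M b =
      M.funPt f (fun j => (s j).eval M b) (fun j => (t j).eval M b) i := by
  simp only [PtTerm.eval, RealTerm.eval]

theorem eval_real_func {M : MetricStructure L X} {V : Type v} (b : V → X) (f : L.Func) (s t i) :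
    (RealTerm.func f s t i).eval M b =
      M.funReal f (fun j => (s j).eval M b) (fun j => (t j).eval M b) i := by
  simp only [RealTerm.evalUp, RealTerm.eval]

theorem eval_dist {M : MetricStructure L X} {V : Type v} (b : V → X) (s t : PtTerm L V) :
    (RealTerm.dist s t).eval M b = dist (s.eval M b) (t.eval M b) := by
  simp only [RealTerm.evalUp, RealTerm.eval]

theorem eval_const {M : MetricStructure L X} {V : Type v} (b : V → X) (r : ℝ) :
    (RealTerm.const r : RealTerm L V).eval M b = r := by
  simp only [RealTerm.evalUp, RealTerm.eval]

theorem eval_var {M : MetricStructure L X} {V : Type v} (b : V → X) (x : V) :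
    (PtTerm.var x : PtTerm L V).eval M b = b x := by
  simp only [PtTerm.eval]

theorem eval_smul {M : MetricStructure L X} {V : Type v} (g : M.aut) (b : V → X) :
    (∀ t : PtTerm L V, t.eval M (fun i => g • b i) = g • t.eval M b) ∧
      ∀ t : RealTerm L V, t.eval M (fun i => g • b i) = t.eval M b := by
  refine term_induction (fun x => by simp only [eval_var]) (fun f s t i hs ht => ?_)
    (fun r => by simp only [eval_const]) (fun s t hs ht => ?_) (fun f s t i hs ht => ?_)
  · simp only [eval_func, hs, ht, funPt_smul]
  · simp only [eval_dist, hs, ht, dist_smul]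
  · simp only [eval_real_func, hs, ht, funReal_smul]

theorem holds_iff_of_qftp_eq {M : MetricStructure L X} {V : Type v} {a b : V → X}
    (h : M.qftp a = M.qftp b) (φ : QFFormula L V) : φ.Holds M a ↔ φ.Holds M b :=
  Set.ext_iff.1 h φ

theorem qftp_smul {M : MetricStructure L X} {V : Type v} (g : M.aut) (b : V → X) :
    M.qftp (fun i => g • b i) = M.qftp b := by
  ext φ
  change φ.Holds M (fun i => g • b i) ↔ φ.Holds M b
  induction φ with
  | eqPt s t => simp only [QFFormula.Holds, (eval_smul g b).1, smul_left_cancel_iff]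
  | eqReal s t => simp only [QFFormula.Holds, (eval_smul g b).2]
  | rel R s t => simp only [QFFormula.Holds, (eval_smul g b).1, (eval_smul g b).2, rel_smul]
  | not φ ih => simp only [QFFormula.Holds, ih]
  | or φ ψ h1 h2 => simp only [QFFormula.Holds, h1, h2]

theorem mem_realizations_qftp {M : MetricStructure L X} {V : Type v} {a b : V → X} :
    b ∈ M.realizations (M.qftp a) ↔ M.qftp b = M.qftp a := by
  constructor
  · intro h
    ext φ
    refine ⟨fun hb => ?_, fun ha => h φ ha⟩
    by_contra ha
    exact h (.not φ) ha hb
  · intro h φ hφ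
    exact (holds_iff_of_qftp_eq h φ).2 hφ

theorem eval_real_eq_of_qftp_eq {M : MetricStructure L X} {V : Type v} {a b : V → X}
    (h : M.qftp a = M.qftp b) (t : RealTerm L V) : t.eval M a = t.eval M b := by
  have := (holds_iff_of_qftp_eq h (.eqReal t (.const (t.eval M b)))).2
  simpa only [QFFormula.Holds, eval_const, forall_const] using this

theorem eval_eq_iff_of_qftp_eq {M : MetricStructure L X} {V : Type v} {a b : V → X}
    (h : M.qftp a = M.qftp b) (s t : PtTerm L V) :
    s.eval M a = t.eval M a ↔ s.eval M b = t.eval M b :=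
  holds_iff_of_qftp_eq h (.eqPt s t)

/-- Real constants are allowed in formulas, so equal types force equal values of real terms. Hence
the real sorts match and the real arguments of functions can be named by terms on both sides. -/
theorem exists_term_of_qftp_eq {M : MetricStructure L X} {V : Type v} {a b : V → X}
    (h : M.qftp a = M.qftp b) :
    (∀ x ∈ M.gen (Set.range a), ∃ t : PtTerm L V, t.eval M a = x ∧
      t.eval M b ∈ M.gen (Set.range b)) ∧
    ∀ r, M.GenReal (Set.range a) r → ∃ t : RealTerm L V, t.eval M a = r ∧ t.eval M b = r ∧
      M.GenReal (Set.range b) r := by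
  refine gen_induction ?_ ?_ ?_ ?_
  · rintro _ ⟨v, rfl⟩
    exact ⟨.var v, eval_var a v, by rw [eval_var]; exact M.subset_gen _ ⟨v, rfl⟩⟩
  · intro f x r i hx hr
    choose s hs hs' using hx
    choose t ht ht' hr' using hr
    refine ⟨.func f s t i, by simp only [eval_func, hs, ht], ?_⟩
    simp only [eval_func, ht']
    exact GenPt.func f _ r i hs' hr'
  · rintro x y ⟨s, rfl, hs⟩ ⟨t, rfl, ht⟩
    have := eval_real_eq_of_qftp_eq h (.dist s t)
    simp only [eval_dist] at this
    refine ⟨.dist s t, by rw [eval_dist], by rw [eval_dist, this], ?_⟩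
    rw [this]
    exact GenReal.dist _ _ hs ht
  · intro f x r i hx hr
    choose s hs hs' using hx
    choose t ht ht' hr' using hr
    have := eval_real_eq_of_qftp_eq h (.func f s t i)
    simp only [eval_real_func, hs, ht, ht'] at this
    refine ⟨.func f s t i, by simp only [eval_real_func, hs, ht],
      by simp only [eval_real_func, ht', this], ?_⟩
    rw [this]
    exact GenReal.func f _ r i hs' hr'

/-- In a homogeneous structure, tuples of the same type generating finitely generated
substructures are conjugate. -/
theorem Homogeneous.exists_aut {M : MetricStructure L X} (hM : M.Homogeneous) {V : Type v}
    {a b : V → X} (h : M.qftp a = M.qftp b) (ha : M.IsFG (M.gen (Set.range a)))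
    (hb : M.IsFG (M.gen (Set.range b))) : ∃ g : M.aut, ∀ i, g • a i = b i := by
  have h1 := (exists_term_of_qftp_eq h).1
  have h2 := (exists_term_of_qftp_eq h.symm).1
  choose s hs hs' using h1
  choose t ht ht' using h2
  -- The value of a term at `a` goes to its value at `b`; this is independent of the chosen term
  -- because the type decides equalities between terms.
  let φ : M.gen (Set.range a) ≃ M.gen (Set.range b) :=
    { toFun := fun x => ⟨_, hs' x x.2⟩
      invFun := fun y => ⟨_, ht' y y.2⟩
      left_inv := fun x => Subtype.ext (by
        have := (eval_eq_iff_of_qftp_eq h (t _ (hs' x x.2)) (s x x.2)).2 (ht _ _)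
        exact this.trans (hs _ _))
      right_inv := fun y => Subtype.ext (by
        have := (eval_eq_iff_of_qftp_eq h (s _ (ht' y y.2)) (t y y.2)).1 (hs _ _)
        exact this.trans (ht _ _)) }
  have hφ : ∀ x : M.gen (Set.range a), (φ x : X) = (s x x.2).eval M b := fun x => rfl
  have hφ' : ∀ (x : M.gen (Set.range a)) (t : PtTerm L V), t.eval M a = x → t.eval M b = φ x := by
    intro x t ht
    rw [hφ, ← eval_eq_iff_of_qftp_eq h, ht, hs]
  have hreal : ∀ r, M.GenReal (M.gen (Set.range a)) r →
      ∃ t : RealTerm L V, t.eval M a = r ∧ t.eval M b = r := fun r hr => by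
    obtain ⟨t, h1, h2, -⟩ := (exists_term_of_qftp_eq h).2 r
      ((gen_subset_and (M := M) subset_rfl).2 r hr)
    exact ⟨t, h1, h2⟩
  have hiso : M.IsIso φ := by
    refine ⟨fun x y => ?_, fun f x r hr i y hy => ?_, fun f x r hr i => ?_, fun R x r hr => ?_⟩
    · have := eval_real_eq_of_qftp_eq h (.dist (s x x.2) (s y y.2))
      simp only [eval_dist, hs] at this
      exact this.symm
    · choose q hq hq' using fun j => hreal (r j) (hr j)
      rw [← hφ' y (.func f (fun j => s (x j) (x j).2) q i) (by simp only [eval_func, hs, hq, hy])]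
      simp only [eval_func, hq', hφ]
    · choose q hq hq' using fun j => hreal (r j) (hr j)
      have := eval_real_eq_of_qftp_eq h (.func f (fun j => s (x j) (x j).2) q i)
      simp only [eval_real_func, hs, hq, hq'] at this
      exact this.symm
    · choose q hq hq' using fun j => hreal (r j) (hr j)
      have := holds_iff_of_qftp_eq h (.rel R (fun j => s (x j) (x j).2) q)
      simp only [QFFormula.Holds, hs, hq, hq'] at this
      exact this.symm
  obtain ⟨g, hg, hgφ⟩ := hM _ _ ha hb φ hiso
  refine ⟨⟨g, hg⟩, fun i => ?_⟩
  have := hgφ ⟨a i, M.subset_gen _ ⟨i, rfl⟩⟩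
  rw [aut_smul_def, this, ← hφ' _ (.var i) (eval_var a i), eval_var]

theorem Homogeneous.exists_aut_of_finite {M : MetricStructure L X} (hM : M.Homogeneous)
    {V : Type v} [Finite V] {a b : V → X} (h : M.qftp a = M.qftp b) :
    ∃ g : M.aut, ∀ i, g • a i = b i :=
  hM.exists_aut h (M.isFG_gen (Set.finite_range a)) (M.isFG_gen (Set.finite_range b))

/-! ### Restrictions of automorphisms -/

/-- The restriction of an automorphism to a set. -/
def smulEquiv {M : MetricStructure L X} (g : M.aut) {A B : Set X} (h : g • A = B) : A ≃ B :=
  (MulAction.toPerm g).subtypeEquiv fun a => by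
    rw [← h, MulAction.toPerm_apply, Set.smul_mem_smul_set_iff]

theorem coe_smulEquiv {M : MetricStructure L X} (g : M.aut) {A B : Set X} (h : g • A = B)
    (x : A) : (smulEquiv g h x : X) = g • (x : X) := rfl

theorem isIso_smulEquiv {M : MetricStructure L X} (g : M.aut) {A B : Set X} (h : g • A = B) :
    M.IsIso (smulEquiv g h) where
  dist_eq x y := by simp only [coe_smulEquiv, dist_smul]
  funPt_eq f x r _ i y hy := by simp only [coe_smulEquiv, funPt_smul, hy]
  funReal_eq f x r _ i := by simp only [coe_smulEquiv, funReal_smul]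
  rel_iff R x r _ := by simp only [coe_smulEquiv, rel_smul]

/-- Over a homogeneous structure, an automorphism of a finitely generated substructure is the
restriction of an automorphism preserving it. -/
theorem Homogeneous.exists_aut_of_isIso {M : MetricStructure L X} (hM : M.Homogeneous)
    {A : Set X} (hA : M.IsFG A) {φ : A ≃ A} (hφ : M.IsIso φ) :
    ∃ g : M.aut, g • A = A ∧ ∀ x : A, g • (x : X) = φ x := by
  obtain ⟨g, hg, hgφ⟩ := hM A A hA hA φ hφ
  refine ⟨⟨g, hg⟩, ?_, hgφ⟩
  ext y
  constructor
  · rintro ⟨x, hx, rfl⟩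
    have := hgφ ⟨x, hx⟩
    change g x ∈ A
    rw [this]
    exact (φ ⟨x, hx⟩).2
  · intro hy
    refine ⟨φ.symm ⟨y, hy⟩, (φ.symm ⟨y, hy⟩).2, (hgφ _).trans ?_⟩
    rw [Equiv.apply_symm_apply]

/-- The restrictions of the `g i` to `gen F` are partial isomorphisms of the substructure generated
by `F` and its images. Homogeneity turns the automorphisms of the larger substructure into global
ones. -/
theorem LocallyFiniteAut.exists_aut {M : MetricStructure L X} (hlf : M.LocallyFiniteAut)
    (hM : M.Homogeneous) {n : ℕ} {F : Set X} (hF : F.Finite) (g : Fin n → M.aut) :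
    ∃ N : Set X, N.Finite ∧ F ⊆ N ∧ ∃ h : Fin n → M.aut, ∀ i,
      (∀ x ∈ F, h i • x = g i • x) ∧ h i • M.gen N = M.gen N := by
  have hfin : (F ∪ ⋃ i, g i • F).Finite := hF.union (Set.finite_iUnion fun i => hF.smul_set)
  obtain ⟨N', ⟨N, hN, rfl⟩, hsub, hψ⟩ := hlf n (M.gen (F ∪ ⋃ i, g i • F)) (M.isFG_gen hfin)
    (fun _ => M.gen F) (fun i => M.gen (g i • F))
    (fun i => ⟨M.isFG_gen hF, gen_mono Set.subset_union_left⟩)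
    (fun i => ⟨M.isFG_gen hF.smul_set,
      gen_mono ((Set.subset_iUnion (fun i => g i • F) i).trans Set.subset_union_right)⟩)
    (fun i => smulEquiv (g i) (smul_gen _ _)) (fun i => isIso_smulEquiv _ _)
  have hFN : F ⊆ M.gen N := (Set.subset_union_left.trans (M.subset_gen _)).trans hsub
  have hgen : M.gen (N ∪ F) = M.gen N :=
    (gen_subset (Set.union_subset (M.subset_gen N) hFN)).antisymm (gen_mono Set.subset_union_left)
  choose ψ hψ hψF using hψ
  choose h hN hh using fun i => hM.exists_aut_of_isIso (M.isFG_gen ‹N.Finite›) (hψ i)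
  -- `F` lies in `gen N` but perhaps not in `N`; adding it to the generators leaves the substructure
  -- unchanged.
  refine ⟨N ∪ F, Set.Finite.union ‹_› hF, Set.subset_union_right, h, fun i => ⟨fun x hx => ?_, ?_⟩⟩
  · have h1 := hψF i ⟨x, M.subset_gen _ hx⟩ ⟨x, hFN hx⟩ rfl
    rw [coe_smulEquiv] at h1
    rw [← h1]
    exact hh i ⟨x, hFN hx⟩
  · rw [hgen, hN i]

theorem isFG_gen_union {M : MetricStructure L X} {A B : Set X} (hA : M.IsFG A) (hB : M.IsFG B) :
    M.IsFG (M.gen (A ∪ B)) := by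
  obtain ⟨F, hF, rfl⟩ := hA
  obtain ⟨G, hG, rfl⟩ := hB
  refine ⟨F ∪ G, hF.union hG, (gen_subset ?_).antisymm (gen_mono ?_)⟩
  · exact Set.union_subset (gen_mono Set.subset_union_left) (gen_mono Set.subset_union_right)
  · exact Set.union_subset_union (M.subset_gen F) (M.subset_gen G)

theorem eqOn_gen {M : MetricStructure L X} {g h : M.aut} {F : Set X}
    (hF : ∀ x ∈ F, g • x = h • x) : ∀ x ∈ M.gen F, g • x = h • x := by
  intro x hx
  have := fix_gen (h⁻¹ * g) F (fun x hx => by rw [mul_smul, hF x hx, inv_smul_smul]) x hx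
  rwa [mul_smul, inv_smul_eq_iff] at this

/-- By homogeneity the independent copy `C'` is the image of `C` under an automorphism `k` fixing
`A`, so all data can be phrased with global automorphisms and finite generating sets. -/
theorem ExtensionProperty.exists_aut {M : MetricStructure L X} (hext : M.ExtensionProperty)
    (hM : M.Homogeneous) {A B C : Set X} (hA : A.Finite) (hB : B.Finite) (hC : C.Finite)
    (hAB : A ⊆ M.gen B) (hAC : A ⊆ M.gen C) :
    ∃ k : M.aut, (∀ x ∈ A, k • x = x) ∧ ∀ φ ψ : M.aut, φ • M.gen A = M.gen A →
      φ • M.gen B = M.gen B → ψ • M.gen (k • C) = M.gen (k • C) → (∀ x ∈ A, φ • x = ψ • x) →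
      ∃ χ : M.aut, (∀ x ∈ B, χ • x = φ • x) ∧ ∀ x ∈ C, χ • k • x = ψ • k • x := by
  obtain ⟨C', hC', ⟨e, rfl, heq⟩, hind⟩ := hext (M.gen A) (M.gen B) (M.gen C) (M.isFG_gen hA)
    (M.isFG_gen hB) (M.isFG_gen hC) (Set.subset_inter (gen_subset hAB) (gen_subset hAC))
  obtain ⟨k, hk⟩ := hM.exists_aut (a := Sum.elim ((↑) : M.gen C → X) ((↑) : M.gen A → X))
    (b := Sum.elim e ((↑) : M.gen A → X)) heq.symm
    (by
      rw [Set.Sum.elim_range, Subtype.range_coe, Subtype.range_coe]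
      exact isFG_gen_union (M.isFG_gen hC) (M.isFG_gen hA))
    (by
      rw [Set.Sum.elim_range, Subtype.range_coe]
      exact isFG_gen_union hC' (M.isFG_gen hA))
  have hkA : ∀ x ∈ A, k • x = x := fun x hx => hk (.inr ⟨x, M.subset_gen A hx⟩)
  have hke : ∀ c : M.gen C, k • (c : X) = e c := fun c => hk (.inl c)
  have hr : Set.range e = M.gen (k • C) := by
    rw [← smul_gen]
    ext y
    constructor
    · rintro ⟨c, rfl⟩
      exact ⟨c, c.2, hke c⟩
    · rintro ⟨c, hc, rfl⟩
      exact ⟨⟨c, hc⟩, (hke ⟨c, hc⟩).symm⟩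
  rw [hr] at hind
  refine ⟨k, hkA, fun φ ψ hφA hφB hψC hφψ => ?_⟩
  have hagree := eqOn_gen hφψ
  have hmem : ∀ x ∈ M.gen A, φ • x ∈ M.gen A := fun x hx => by
    rw [← hφA]
    exact Set.smul_mem_smul_set hx
  obtain ⟨χ, hχ, hχB, hχC⟩ := hind (smulEquiv φ hφB) (smulEquiv ψ hψC) (isIso_smulEquiv _ _)
    (isIso_smulEquiv _ _) (fun x hx => hmem x hx)
    (fun x hx => by rw [coe_smulEquiv, ← hagree x hx]; exact hmem x hx)
    (fun x y hx hxy => by rw [coe_smulEquiv, coe_smulEquiv, hagree x hx, hxy])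
  obtain ⟨g, -, hg⟩ := hM.exists_aut_of_isIso
    (isFG_gen_union (M.isFG_gen hB) (M.isFG_gen (hC.smul_set (a := k)))) hχ
  have hBs := M.subset_gen (M.gen B ∪ M.gen (k • C))
  refine ⟨g, fun x hx => ?_, fun x hx => ?_⟩
  · have hx' := M.subset_gen B hx
    exact (hg ⟨x, hBs (.inl hx')⟩).trans (hχB ⟨x, hx'⟩ _ rfl)
  · have hx' := M.subset_gen (k • C) (Set.smul_mem_smul_set hx)
    exact (hg ⟨k • x, hBs (.inr hx')⟩).trans (hχC ⟨k • x, hx'⟩ _ rfl)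

end MetricStructure

/-! ### Countable hulls -/

/-- A Löwenheim–Skolem lemma: countable sets can be enlarged to countable sets containing witnesses
for a monotone family of requirements with finitely many parameters. -/
theorem exists_countable_hull {X : Type u} {G : Type v}
    (P : Finset X → Finset X → Finset X → (n : ℕ) → (Fin n → G) → Set X → Set G → Prop)
    (mono : ∀ A B C n g D D' S S', D ⊆ D' → S ⊆ S' → P A B C n g D S → P A B C n g D' S')
    (hP : ∀ A B C n g, ∃ D S, D.Countable ∧ S.Countable ∧ P A B C n g D S)
    {D₀ : Set X} {S₀ : Set G} (hD₀ : D₀.Countable) (hS₀ : S₀.Countable) :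
    ∃ D S, D.Countable ∧ S.Countable ∧ D₀ ⊆ D ∧ S₀ ⊆ S ∧
      ∀ (A B C : Finset X) (n : ℕ) (g : Fin n → G), (A : Set X) ⊆ D → (B : Set X) ⊆ D →
        (C : Set X) ⊆ D → (∀ i, g i ∈ S) → P A B C n g D S := by
  choose d s hd hs hds using hP
  let lift : ∀ D : Set X, Finset D → Finset X := fun D => Finset.map (Function.Embedding.subtype _)
  have hlift : ∀ (D : Set X) (A : Finset X), (A : Set X) ⊆ D → ∃ A' : Finset D, lift D A' = A := by
    classical
    intro D A hA
    exact ⟨A.subtype (· ∈ D), Finset.subtype_map_of_mem fun x hx => hA hx⟩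
  let I : Set X × Set G → Type (max u v) := fun q =>
    Finset q.1 × Finset q.1 × Finset q.1 × Σ n, (Fin n → q.2)
  let next : Set X × Set G → Set X × Set G := fun q =>
    (q.1 ∪ ⋃ t : I q, d (lift _ t.1) (lift _ t.2.1) (lift _ t.2.2.1) t.2.2.2.1
        fun i => (t.2.2.2.2 i : G),
      q.2 ∪ ⋃ t : I q, s (lift _ t.1) (lift _ t.2.1) (lift _ t.2.2.1) t.2.2.2.1
        fun i => (t.2.2.2.2 i : G))
  -- Iterate "add witnesses for all finite parameters" countably often; a finite tuple of parameters
  -- already occurs at a finite stage.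
  let st : ℕ → Set X × Set G := fun n => next^[n] (D₀, S₀)
  have hst : ∀ n, st (n + 1) = next (st n) := fun n => Function.iterate_succ_apply' _ _ _
  have hcount : ∀ n, (st n).1.Countable ∧ (st n).2.Countable := by
    intro n
    induction n with
    | zero => exact ⟨hD₀, hS₀⟩
    | succ n ih =>
      have := ih.1.to_subtype
      have := ih.2.to_subtype
      have : Countable (I (st n)) := by dsimp only [I]; infer_instance
      rw [hst]
      exact ⟨ih.1.union (Set.countable_iUnion fun _ => hd _ _ _ _ _),
        ih.2.union (Set.countable_iUnion fun _ => hs _ _ _ _ _)⟩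
  have hmono : Monotone st := monotone_nat_of_le_succ fun n => by
    rw [hst]
    exact ⟨Set.subset_union_left, Set.subset_union_left⟩
  refine ⟨⋃ n, (st n).1, ⋃ n, (st n).2, Set.countable_iUnion fun n => (hcount n).1,
    Set.countable_iUnion fun n => (hcount n).2, Set.subset_iUnion (fun n => (st n).1) 0,
    Set.subset_iUnion (fun n => (st n).2) 0, fun A B C n g hA hB hC hg => ?_⟩
  have hfin : ∀ A : Finset X, (A : Set X) ⊆ ⋃ n, (st n).1 → ∃ n, (A : Set X) ⊆ (st n).1 :=
    fun A hA => Directed.exists_mem_subset_of_finset_subset_biUnion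
      (Monotone.directed_le fun a b h => (hmono h).1) hA
  obtain ⟨a, ha⟩ := hfin A hA
  obtain ⟨b, hb⟩ := hfin B hB
  obtain ⟨c, hc⟩ := hfin C hC
  choose e he using fun i => Set.mem_iUnion.1 (hg i)
  let m := max a (max b (max c (Finset.univ.sup e)))
  have ham : a ≤ m := le_max_left _ _
  have hbm : b ≤ m := (le_max_left _ _).trans (le_max_right _ _)
  have hcm : c ≤ m := ((le_max_left _ _).trans (le_max_right _ _)).trans (le_max_right _ _)
  have hem : ∀ i, e i ≤ m := fun i => (Finset.le_sup (Finset.mem_univ i)).trans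
    (((le_max_right _ _).trans (le_max_right _ _)).trans (le_max_right _ _))
  obtain ⟨A', rfl⟩ := hlift (st m).1 A (ha.trans (hmono ham).1)
  obtain ⟨B', rfl⟩ := hlift (st m).1 B (hb.trans (hmono hbm).1)
  obtain ⟨C', rfl⟩ := hlift (st m).1 C (hc.trans (hmono hcm).1)
  let t : I (st m) := (A', B', C', ⟨n, fun i => ⟨g i, (hmono (hem i)).2 (he i)⟩⟩)
  refine mono _ _ _ _ _ _ _ _ _ ?_ ?_ (hds (lift _ A') (lift _ B') (lift _ C') n g)
  · refine Set.Subset.trans ?_ (Set.subset_iUnion _ (m + 1))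
    rw [hst]
    exact (Set.subset_iUnion (fun t : I (st m) => d (lift _ t.1) (lift _ t.2.1) (lift _ t.2.2.1)
      t.2.2.2.1 fun i => (t.2.2.2.2 i : G)) t).trans Set.subset_union_right
  · refine Set.Subset.trans ?_ (Set.subset_iUnion _ (m + 1))
    rw [hst]
    exact (Set.subset_iUnion (fun t : I (st m) => s (lift _ t.1) (lift _ t.2.1) (lift _ t.2.2.1)
      t.2.2.2.1 fun i => (t.2.2.2.2 i : G)) t).trans Set.subset_union_right

-- Limits of automorphisms and the closure of a group acting on a subset

namespace MetricStructure

variable {L : MetricSignature} {X : Type u} [MetricSpace X]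

open Filter in
-- The limits of `γ n` and of the inverses are mutually inverse isometries. Functions pass to the
-- limit by continuity; a closed relation passes in one direction along `γ n` and in the other along
-- `(γ n)⁻¹`.
theorem exists_aut_tendsto [CompleteSpace X] {M : MetricStructure L X} (γ : ℕ → M.aut)
    (h1 : ∀ x : X, CauchySeq fun n => γ n • x) (h2 : ∀ x : X, CauchySeq fun n => (γ n)⁻¹ • x) :
    ∃ g : M.aut, ∀ x : X, Tendsto (fun n => γ n • x) atTop (nhds (g • x)) := by
  choose p hp using fun x => cauchySeq_tendsto_of_complete (h1 x)
  choose q hq using fun x => cauchySeq_tendsto_of_complete (h2 x)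
  have hpq : ∀ x, p (q x) = x := fun x => by
    refine tendsto_nhds_unique (hp (q x)) (tendsto_iff_dist_tendsto_zero.2 ?_)
    refine (tendsto_iff_dist_tendsto_zero.1 (hq x)).congr fun n => ?_
    rw [← dist_smul (γ n), smul_inv_smul, dist_comm]
  have hqp : ∀ x, q (p x) = x := fun x => by
    refine tendsto_nhds_unique (hq (p x)) (tendsto_iff_dist_tendsto_zero.2 ?_)
    refine (tendsto_iff_dist_tendsto_zero.1 (hp x)).congr fun n => ?_
    rw [← dist_smul (γ n)⁻¹, inv_smul_smul, dist_comm]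
  have hiso : Isometry p := Isometry.of_dist_eq fun x y =>
    tendsto_nhds_unique ((hp x).dist (hp y)) (by simp only [dist_smul]; exact tendsto_const_nhds)
  let g : X ≃ᵢ X := ⟨⟨p, q, hqp, hpq⟩, hiso⟩
  have hvec : ∀ {k : ℕ} (x : Fin k → X), Tendsto (fun n j => γ n • x j) atTop
      (nhds fun j => p (x j)) := fun x => tendsto_pi_nhds.2 fun j => hp (x j)
  refine ⟨⟨g, fun f x r i => ?_, fun f x r i => ?_, fun R x r => ?_⟩, hp⟩
  · have h := (((continuous_apply i).comp (M.continuous_funPt f r)).tendsto _).comp (hvec x)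
    refine tendsto_nhds_unique h ((hp (M.funPt f x r i)).congr fun n => ?_)
    exact (funPt_smul (γ n) f x r i).symm
  · have h := (((continuous_apply i).comp (M.continuous_funReal f r)).tendsto _).comp (hvec x)
    refine tendsto_nhds_unique h (tendsto_const_nhds.congr fun n => ?_)
    exact (funReal_smul (γ n) f x r i).symm
  · constructor
    · intro h
      have hv : Tendsto (fun n j => (γ n)⁻¹ • p (x j)) atTop (nhds x) :=
        tendsto_pi_nhds.2 fun j => by simpa only [hqp] using hq (p (x j))
      exact (M.isClosed_rel R r).mem_of_tendsto hv
        (Eventually.of_forall fun n => (rel_smul (γ n)⁻¹ R _ r).2 h)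
    · intro h
      exact (M.isClosed_rel R r).mem_of_tendsto (hvec x)
        (Eventually.of_forall fun n => (rel_smul (γ n) R _ r).2 h)

/-- The elements of the automorphism group which agree, on any finite subset of `D`, with an
element of `S`, together with their inverses. -/
def approxSubgroup (M : MetricStructure L X) (D : Set X) (S : Subgroup M.aut)
    (hD : ∀ g ∈ S, ∀ x : X, x ∈ D → g • x ∈ D) : Subgroup M.aut where
  carrier := {g | ∀ F : Finset X, (F : Set X) ⊆ D →
    ∃ s ∈ S, ∀ x ∈ F, s • x = g • x ∧ s⁻¹ • x = g⁻¹ • x}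
  one_mem' _ _ := ⟨1, S.one_mem, fun _ _ => ⟨rfl, rfl⟩⟩
  inv_mem' := by
    intro g hg F hF
    obtain ⟨s, hs, h⟩ := hg F hF
    exact ⟨s⁻¹, S.inv_mem hs, fun x hx => ⟨(h x hx).2, by simpa using (h x hx).1⟩⟩
  mul_mem' := by
    classical
    intro g h hg hh F hF
    have hhD : ∀ x ∈ F, h • x ∈ D := fun x hx => by
      obtain ⟨s, hs, hsx⟩ := hh {x} (by simpa using hF hx)
      rw [← (hsx x (by simp)).1]
      exact hD s hs x (hF hx)
    have hgD : ∀ x ∈ F, g⁻¹ • x ∈ D := fun x hx => by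
      obtain ⟨s, hs, hsx⟩ := hg {x} (by simpa using hF hx)
      rw [← (hsx x (by simp)).2]
      exact hD _ (S.inv_mem hs) x (hF hx)
    obtain ⟨s, hs, hsx⟩ := hg (F ∪ F.image (h • ·)) (by
      intro y hy
      simp only [Finset.coe_union, Finset.coe_image, Set.mem_union, Set.mem_image] at hy
      rcases hy with hy | ⟨x, hx, rfl⟩
      exacts [hF hy, hhD x hx])
    obtain ⟨t, ht, htx⟩ := hh (F ∪ F.image (g⁻¹ • ·)) (by
      intro y hy
      simp only [Finset.coe_union, Finset.coe_image, Set.mem_union, Set.mem_image] at hy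
      rcases hy with hy | ⟨x, hx, rfl⟩
      exacts [hF hy, hgD x hx])
    refine ⟨s * t, S.mul_mem hs ht, fun x hx => ⟨?_, ?_⟩⟩
    · rw [mul_smul, (htx x (by simp [hx])).1, mul_smul,
        (hsx _ (Finset.mem_union_right _ (Finset.mem_image_of_mem _ hx))).1]
    · rw [mul_inv_rev, mul_inv_rev, mul_smul, (hsx x (by simp [hx])).2, mul_smul,
        (htx _ (Finset.mem_union_right _ (Finset.mem_image_of_mem _ hx))).2]

/-- The invariant set `D` as a set with an action of `approxSubgroup`. -/
def approxSet (M : MetricStructure L X) (D : Set X) (S : Subgroup M.aut)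
    (hD : ∀ g ∈ S, ∀ x : X, x ∈ D → g • x ∈ D) : SubMulAction (M.approxSubgroup D S hD) X where
  carrier := D
  smul_mem' := by
    rintro ⟨g, hg⟩ x hx
    obtain ⟨s, hs, h⟩ := hg {x} (by simpa using hx)
    change g • x ∈ D
    rw [← (h x (by simp)).1]
    exact hD s hs x hx

end MetricStructure

-- Countable hulls containing witnesses

namespace MetricStructure

variable {L : MetricSignature} {X : Type u} [MetricSpace X]

/-- A set of points `D` and a group of automorphisms `S` preserving it which contain witnesses for
locally finite automorphisms and the extension property. -/
structure IsWitnessClosed (M : MetricStructure L X) (D : Set X) (S : Subgroup M.aut) : Prop where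
  smul_mem : ∀ g ∈ S, ∀ x : X, x ∈ D → g • x ∈ D
  locallyFinite : ∀ (A : Finset X) (n : ℕ) (g : Fin n → M.aut), (A : Set X) ⊆ D → (∀ i, g i ∈ S) →
    ∃ N : Finset X, A ⊆ N ∧ (N : Set X) ⊆ D ∧ ∃ h : Fin n → M.aut, ∀ i, h i ∈ S ∧
      (∀ x ∈ A, h i • x = g i • x) ∧ h i • M.gen N = M.gen N
  extension : ∀ A B C : Finset X, (A : Set X) ⊆ D → (B : Set X) ⊆ D → (C : Set X) ⊆ D →
    (A : Set X) ⊆ M.gen B → (A : Set X) ⊆ M.gen C →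
    ∃ k ∈ S, (∀ x ∈ A, k • x = x) ∧ ∀ φ ∈ S, ∀ ψ ∈ S, φ • M.gen A = M.gen A →
      φ • M.gen B = M.gen B → ψ • M.gen (k • (C : Set X)) = M.gen (k • (C : Set X)) →
      (∀ x ∈ A, φ • x = ψ • x) →
      ∃ χ ∈ S, (∀ x ∈ B, χ • x = φ • x) ∧ ∀ x ∈ C, χ • k • x = ψ • k • x

/-- A countable elementary-submodel argument. The final clause reflects `W`: an automorphism outside
`W` that fixes `A` has a counterpart in `S`. -/
theorem exists_isWitnessClosed {M : MetricStructure L X} (hM : M.Homogeneous)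
    (hlf : M.LocallyFiniteAut) (hext : M.ExtensionProperty) (W : Set M.aut)
    {D₀ : Set X} {S₀ : Set M.aut} (hD₀ : D₀.Countable) (hS₀ : S₀.Countable) :
    ∃ (D : Set X) (S : Subgroup M.aut), D.Countable ∧ D₀ ⊆ D ∧ S₀ ⊆ S ∧ M.IsWitnessClosed D S ∧
      ∀ A : Finset X, (A : Set X) ⊆ D → (∀ g ∈ S, (∀ x ∈ A, g • x = x) → g ∈ W) →
        ∀ g : M.aut, (∀ x ∈ A, g • x = x) → g ∈ W := by
  classical
  let P1 : Finset X → (n : ℕ) → (Fin n → M.aut) → Set X → Set M.aut → Prop := fun A n g D S =>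
    ∃ N : Finset X, A ⊆ N ∧ (N : Set X) ⊆ D ∧ ∃ h : Fin n → M.aut, ∀ i, h i ∈ S ∧
      (∀ x ∈ A, h i • x = g i • x) ∧ h i • M.gen N = M.gen N
  let Q : Finset X → Finset X → Finset X → M.aut → Prop := fun A B C k =>
    (∀ x ∈ A, k • x = x) ∧ ∀ φ ψ : M.aut, φ • M.gen A = M.gen A →
      φ • M.gen B = M.gen B → ψ • M.gen (k • (C : Set X)) = M.gen (k • (C : Set X)) →
      (∀ x ∈ A, φ • x = ψ • x) →
      ∃ χ : M.aut, (∀ x ∈ B, χ • x = φ • x) ∧ ∀ x ∈ C, χ • k • x = ψ • k • x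
  let P2 : Finset X → Finset X → Finset X → Set M.aut → Prop := fun A B C S =>
    (A : Set X) ⊆ M.gen B → (A : Set X) ⊆ M.gen C → ∃ k ∈ S, Q A B C k
  -- In `P2` the element `k` is good for all of `Aut(M)`. The common extension `χ` found for given
  -- `φ, ψ ∈ S` must itself be brought into `S`, which is a separate requirement with parameters `φ,
  -- ψ`.
  let P3 : Finset X → Finset X → M.aut → M.aut → Set M.aut → Prop := fun B C φ ψ S =>
    (∃ χ : M.aut, (∀ x ∈ B, χ • x = φ • x) ∧ ∀ x ∈ C, χ • x = ψ • x) →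
    ∃ χ ∈ S, (∀ x ∈ B, χ • x = φ • x) ∧ ∀ x ∈ C, χ • x = ψ • x
  let P4 : Finset X → M.aut → M.aut → Set X → Set M.aut → Prop := fun A φ ψ D S =>
    φ * ψ ∈ S ∧ φ⁻¹ ∈ S ∧ ∀ x ∈ A, φ • x ∈ D
  let P5 : Finset X → Set M.aut → Prop := fun A S =>
    (∃ g : M.aut, (∀ x ∈ A, g • x = x) ∧ g ∉ W) → ∃ g ∈ S, (∀ x ∈ A, g • x = x) ∧ g ∉ W
  obtain ⟨D, S, hDc, hSc, hD, hS, hP⟩ := exists_countable_hull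
    (fun A B C n g D S => P1 A n g D S ∧ P2 A B C S ∧ (∀ i j, P3 B C (g i) (g j) S) ∧
      (∀ i j, P4 A (g i) (g j) D S) ∧ P5 A S) (by
      rintro A B C n g D D' S S' hD hS ⟨⟨N, h1, h2, h, h3⟩, h4, h5, h6, h7⟩
      refine ⟨⟨N, h1, h2.trans hD, h, fun i => ⟨hS (h3 i).1, (h3 i).2⟩⟩, fun a b => ?_,
        fun i j a => ?_, fun i j => ⟨hS (h6 i j).1, hS (h6 i j).2.1,
        fun x hx => hD ((h6 i j).2.2 x hx)⟩, fun a => ?_⟩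
      · obtain ⟨k, hk, hk'⟩ := h4 a b
        exact ⟨k, hS hk, hk'⟩
      · obtain ⟨k, hk, hk'⟩ := h5 i j a
        exact ⟨k, hS hk, hk'⟩
      · obtain ⟨k, hk, hk'⟩ := h7 a
        exact ⟨k, hS hk, hk'⟩) (by
      intro A B C n g
      obtain ⟨N, hN, hAN, h, hh⟩ := hlf.exists_aut hM A.finite_toSet g
      lift N to Finset X using hN
      have e2 : ∃ S : Set M.aut, S.Countable ∧ P2 A B C S := by
        by_cases hc : (A : Set X) ⊆ M.gen B ∧ (A : Set X) ⊆ M.gen C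
        · obtain ⟨k, hk⟩ := hext.exists_aut hM A.finite_toSet B.finite_toSet C.finite_toSet
            hc.1 hc.2
          exact ⟨{k}, Set.countable_singleton k, fun _ _ => ⟨k, rfl, hk⟩⟩
        · exact ⟨∅, Set.countable_empty, fun h1 h2 => absurd ⟨h1, h2⟩ hc⟩
      have e3 : ∀ i j, ∃ χ : M.aut, P3 B C (g i) (g j) {χ} := fun i j => by
        by_cases hc : ∃ χ : M.aut, (∀ x ∈ B, χ • x = g i • x) ∧ ∀ x ∈ C, χ • x = g j • x
        · obtain ⟨χ, hχ⟩ := hc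
          exact ⟨χ, fun _ => ⟨χ, rfl, hχ⟩⟩
        · exact ⟨1, fun h => absurd h hc⟩
      have e5 : ∃ g : M.aut, P5 A {g} := by
        by_cases hc : ∃ g : M.aut, (∀ x ∈ A, g • x = x) ∧ g ∉ W
        · obtain ⟨χ, hχ⟩ := hc
          exact ⟨χ, fun _ => ⟨χ, rfl, hχ⟩⟩
        · exact ⟨1, fun h => absurd h hc⟩
      obtain ⟨S2, hS2, h2⟩ := e2
      choose χ hχ using e3
      obtain ⟨γ, hγ⟩ := e5
      refine ⟨(N : Set X) ∪ ⋃ i, (A.image (g i • ·) : Finset X), Set.range h ∪ S2 ∪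
        Set.range (fun q : Fin n × Fin n => χ q.1 q.2) ∪
        Set.range (fun q : Fin n × Fin n => g q.1 * g q.2) ∪ Set.range (fun i => (g i)⁻¹) ∪ {γ},
        N.countable_toSet.union (Set.countable_iUnion fun i => Finset.countable_toSet _),
        (((((Set.countable_range _).union hS2).union (Set.countable_range _)).union
          (Set.countable_range _)).union (Set.countable_range _)).union (Set.countable_singleton _),
        ⟨N, Finset.coe_subset.1 hAN, Set.subset_union_left, h, fun i => ⟨by simp, hh i⟩⟩,
        fun a b => ?_, fun i j a => ?_, fun i j => ⟨?_, ?_, ?_⟩, fun a => ?_⟩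
      · obtain ⟨k, hk, hk'⟩ := h2 a b
        exact ⟨k, by simp [hk], hk'⟩
      · obtain ⟨k, rfl, hk'⟩ := hχ i j a
        exact ⟨_, .inl (.inl (.inl (.inr ⟨(i, j), rfl⟩))), hk'⟩
      · exact .inl (.inl (.inr ⟨(i, j), rfl⟩))
      · exact .inl (.inr ⟨i, rfl⟩)
      · exact fun x hx => .inr (Set.mem_iUnion.2 ⟨i, Finset.mem_image_of_mem _ hx⟩)
      · obtain ⟨k, rfl, hk'⟩ := hγ a
        exact ⟨_, .inr rfl, hk'⟩) hD₀ (hS₀.union (Set.countable_singleton 1))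
  have h4 : ∀ (A : Finset X) (φ ψ : M.aut), (A : Set X) ⊆ D → φ ∈ S → ψ ∈ S → P4 A φ ψ D S :=
    fun A φ ψ hA hφ hψ => (hP A ∅ ∅ 2 ![φ, ψ] hA (by simp) (by simp)
      (by simp [Fin.forall_fin_two, hφ, hψ])).2.2.2.1 0 1
  have h0 : ((∅ : Finset X) : Set X) ⊆ D := by simp
  let S' : Subgroup M.aut :=
    { carrier := S
      one_mem' := hS (.inr rfl)
      mul_mem' := fun ha hb => (h4 ∅ _ _ h0 ha hb).1
      inv_mem' := fun ha => (h4 ∅ _ _ h0 ha ha).2.1 }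
  have hsmul : ∀ g ∈ S, ∀ x : X, x ∈ D → g • x ∈ D := fun g hg x hx =>
    (h4 {x} g g (by simpa using hx) hg hg).2.2 x (by simp)
  refine ⟨D, S', hDc, hD, Set.subset_union_left.trans hS, ⟨hsmul, fun A n g hA hg => ?_,
    fun A B C hA hB hC hAB hAC => ?_⟩, fun A hA hW g hg => ?_⟩
  · exact (hP A ∅ ∅ n g hA (by simp) (by simp) hg).1
  · obtain ⟨k, hk, hkA, hkQ⟩ := (hP A B C 0 Fin.elim0 hA hB hC (fun i => i.elim0)).2.1 hAB hAC
    refine ⟨k, hk, hkA, fun φ hφ ψ hψ a b c d => ?_⟩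
    obtain ⟨χ, hχ1, hχ2⟩ := (hP ∅ B (C.image (k • ·)) 2 ![φ, ψ] h0 hB (by
      intro y hy
      simp only [Finset.coe_image, Set.mem_image] at hy
      obtain ⟨x, hx, rfl⟩ := hy
      exact hsmul k hk x (hC hx)) (by
      simpa [Fin.forall_fin_two] using ⟨hφ, hψ⟩)).2.2.1 0 1 (by
        obtain ⟨χ, h1, h2⟩ := hkQ φ ψ a b c d
        exact ⟨χ, h1, fun x hx => by
          obtain ⟨x, hx', rfl⟩ := Finset.mem_image.1 hx
          exact h2 x hx'⟩)
    exact ⟨χ, hχ1, hχ2.1, fun x hx => hχ2.2 _ (Finset.mem_image_of_mem _ hx)⟩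
  · by_contra hgW
    obtain ⟨γ, h1, h2, h3⟩ := (hP A ∅ ∅ 0 Fin.elim0 hA (by simp) (by simp)
      (fun i => i.elim0)).2.2.2.2 ⟨g, hg, hgW⟩
    exact h3 (hW γ h1 h2)

end MetricStructure

-- The ample action on a countable dense set, and transfer to the automorphism group

namespace MetricStructure

variable {L : MetricSignature} {X : Type u} [MetricSpace X]

theorem smul_gen_congr {M : MetricStructure L X} {g h : M.aut} {F : Set X}
    (hF : ∀ x ∈ F, g • x = h • x) : g • M.gen F = h • M.gen F :=
  Set.image_congr (eqOn_gen hF)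

theorem smul_gen_eq {M : MetricStructure L X} {g : M.aut} {F : Set X}
    (h : ∀ x ∈ F, g • x ∈ M.gen F) (h' : ∀ x ∈ F, g⁻¹ • x ∈ M.gen F) :
    g • M.gen F = M.gen F := by
  have key : ∀ g : M.aut, (∀ x ∈ F, g • x ∈ M.gen F) → g • M.gen F ⊆ M.gen F := fun g hg => by
    rw [smul_gen]
    refine gen_subset ?_
    rintro _ ⟨x, hx, rfl⟩
    exact hg x hx
  refine (key g h).antisymm ?_
  rw [Set.subset_smul_set_iff]
  exact key g⁻¹ h'

section Approx

variable {M : MetricStructure L X} {D : Set X} {S : Subgroup M.aut}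
  {hD : ∀ g ∈ S, ∀ x : X, x ∈ D → g • x ∈ D}

/-- The trace on `D` of the closure operator given by generated substructures. -/
def approxClosure (M : MetricStructure L X) (D : Set X) (S : Subgroup M.aut)
    (hD : ∀ g ∈ S, ∀ x : X, x ∈ D → g • x ∈ D) (s : Set (M.approxSet D S hD)) :
    Set (M.approxSet D S hD) :=
  {x | (x : X) ∈ M.gen ((↑) '' s)}

theorem le_approxSubgroup : S ≤ M.approxSubgroup D S hD :=
  fun s hs _ _ => ⟨s, hs, fun _ _ => ⟨rfl, rfl⟩⟩

theorem image_coe_smul (g : M.approxSubgroup D S hD) (s : Set (M.approxSet D S hD)) :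
    ((↑) '' (g • s) : Set X) = (g : M.aut) • ((↑) '' s : Set X) := by
  rw [← Set.image_smul, ← Set.image_smul, Set.image_image, Set.image_image]
  rfl

theorem mem_approxClosure {s : Set (M.approxSet D S hD)} {x : M.approxSet D S hD} :
    x ∈ M.approxClosure D S hD s ↔ (x : X) ∈ M.gen ((↑) '' s) := Iff.rfl

theorem smul_approxClosure (g : M.approxSubgroup D S hD) (s : Set (M.approxSet D S hD)) :
    g • M.approxClosure D S hD s = M.approxClosure D S hD (g • s) := by
  ext x
  rw [Set.mem_smul_set_iff_inv_smul_mem, mem_approxClosure, mem_approxClosure, image_coe_smul,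
    ← smul_gen, Set.mem_smul_set_iff_inv_smul_mem]
  rfl

/-- The trace on `D` already contains the generators, so its invariance under `g` and `g⁻¹` forces
invariance of the whole generated substructure. -/
theorem smul_approxClosure_eq_iff (g : M.approxSubgroup D S hD) (s : Set (M.approxSet D S hD)) :
    g • M.approxClosure D S hD s = M.approxClosure D S hD s ↔
      (g : M.aut) • M.gen ((↑) '' s) = M.gen ((↑) '' s) := by
  constructor
  · intro h
    have hs : ∀ x ∈ s, x ∈ M.approxClosure D S hD s :=
      fun x hx => M.subset_gen _ (Set.mem_image_of_mem _ hx)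
    have h' : g⁻¹ • M.approxClosure D S hD s = M.approxClosure D S hD s :=
      inv_smul_eq_iff.2 h.symm
    refine smul_gen_eq ?_ ?_
    · rintro _ ⟨x, hx, rfl⟩
      have : g • x ∈ M.approxClosure D S hD s := by
        rw [← h]; exact Set.smul_mem_smul_set (hs x hx)
      exact this
    · rintro _ ⟨x, hx, rfl⟩
      have : g⁻¹ • x ∈ M.approxClosure D S hD s := by
        rw [← h']; exact Set.smul_mem_smul_set (hs x hx)
      exact this
  · intro h
    rw [smul_approxClosure]
    ext x
    rw [mem_approxClosure, mem_approxClosure, image_coe_smul, ← smul_gen, h]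

/-- Approximants that stabilize at each point of the dense set `D` are isometries, so they are
Cauchy at every point of `X`; the limit automorphism has the prescribed values on `D`. -/
theorem approxSet_complete [CompleteSpace X] (hDc : D.Countable) (hDd : Dense D)
    (p q : M.approxSet D S hD → M.approxSet D S hD)
    (hpq : ∀ F : Finset (M.approxSet D S hD), ∃ g : M.approxSubgroup D S hD,
      ∀ d ∈ F, g • d = p d ∧ g⁻¹ • d = q d) : ∃ g : M.approxSubgroup D S hD, ∀ d, g • d = p d := by
  classical
  have : Countable (M.approxSet D S hD) := hDc.to_subtype
  obtain ⟨e⟩ := nonempty_encodable (M.approxSet D S hD)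
  let F : ℕ → Finset (M.approxSet D S hD) := fun n =>
    (Finset.range n).biUnion fun i => (Encodable.decode i : Option (M.approxSet D S hD)).toFinset
  have hF : ∀ d n, Encodable.encode d < n → d ∈ F n := fun d n h =>
    Finset.mem_biUnion.2 ⟨_, Finset.mem_range.2 h, by simp⟩
  choose γ hγ using fun n => hpq (F n)
  have hγ1 : ∀ (d : M.approxSet D S hD) n, Encodable.encode d < n →
      (γ n : M.aut) • (d : X) = p d := fun d n h =>
    congrArg Subtype.val (hγ n d (hF d n h)).1
  have hγ2 : ∀ (d : M.approxSet D S hD) n, Encodable.encode d < n →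
      (γ n : M.aut)⁻¹ • (d : X) = q d := fun d n h =>
    congrArg Subtype.val (hγ n d (hF d n h)).2
  have cauchy : ∀ (t : ℕ → M.aut) (r : M.approxSet D S hD → M.approxSet D S hD),
      (∀ (d : M.approxSet D S hD) n, Encodable.encode d < n → t n • (d : X) = r d) →
      ∀ x : X, CauchySeq fun n => t n • x := by
    intro t r ht x
    refine Metric.cauchySeq_iff'.2 fun ε hε => ?_
    obtain ⟨d, hd, hxd⟩ := hDd.exists_dist_lt x (half_pos hε)
    let d' : M.approxSet D S hD := ⟨d, hd⟩
    refine ⟨Encodable.encode d' + 1, fun n hn => ?_⟩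
    calc dist (t n • x) (t (Encodable.encode d' + 1) • x)
        ≤ dist (t n • x) (t n • d) + dist (t n • d) (t (Encodable.encode d' + 1) • x) :=
          dist_triangle _ _ _
      _ = dist x d + dist d x := by
          rw [dist_smul, ht d' n (by omega), ← ht d' (Encodable.encode d' + 1) (by omega),
            dist_smul]
      _ < ε := by rw [dist_comm d x]; linarith
  obtain ⟨g, hg⟩ := exists_aut_tendsto (fun n => (γ n : M.aut)) (cauchy _ p hγ1)
    (cauchy _ q hγ2)
  have hgp : ∀ d : M.approxSet D S hD, g • (d : X) = p d := fun d =>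
    tendsto_nhds_unique (hg d) (tendsto_const_nhds.congr'
      (Filter.eventually_atTop.2 ⟨Encodable.encode d + 1, fun n hn => (hγ1 d n (by omega)).symm⟩))
  have hgq : ∀ d : M.approxSet D S hD, g⁻¹ • (d : X) = q d := fun d => by
    let n := max (Encodable.encode d) (Encodable.encode (q d)) + 1
    rw [inv_smul_eq_iff, hgp, ← hγ1 (q d) n (by omega), ← hγ2 d n (by omega), smul_inv_smul]
  -- On a finite subset of `D` the limit agrees, together with its inverse, with some `γ n`, which
  -- agrees there with an element of `S`.
  refine ⟨⟨g, fun E hE => ?_⟩, fun d => Subtype.ext (hgp d)⟩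
  let E' : Finset (M.approxSet D S hD) := E.attach.image fun x : {x // x ∈ E} => ⟨(x : X), hE x.2⟩
  obtain ⟨s, hs, hsE⟩ := (γ (E'.sup Encodable.encode + 1)).2 E hE
  refine ⟨s, hs, fun x hx => ?_⟩
  have hxE' : (⟨x, hE hx⟩ : M.approxSet D S hD) ∈ E' :=
    Finset.mem_image.2 ⟨⟨x, hx⟩, Finset.mem_attach _ _, rfl⟩
  have hlt := Nat.lt_succ_of_le (Finset.le_sup (f := Encodable.encode) hxE')
  exact ⟨(hsE x hx).1.trans ((hγ1 _ _ hlt).trans (hgp _).symm),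
    (hsE x hx).2.trans ((hγ2 _ _ hlt).trans (hgq _).symm)⟩

theorem approxSet_faithful (hDd : Dense D) :
    FaithfulSMul (M.approxSubgroup D S hD) (M.approxSet D S hD) where
  eq_of_smul_eq_smul := by
    intro g h hgh
    refine Subtype.ext (Subtype.ext (IsometryEquiv.ext fun x => ?_))
    refine congrFun (Continuous.ext_on hDd (g : M.aut).1.continuous (h : M.aut).1.continuous ?_) x
    exact fun d hd => congrArg Subtype.val (hgh ⟨d, hd⟩)

/-- Local finiteness and extension depend only on the values of the given elements on finite subsets
of `D`, where they may be replaced by elements of `S`; the witnesses then come from `hDS`. -/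
theorem IsWitnessClosed.ampleAction [CompleteSpace X] (hDS : M.IsWitnessClosed D S)
    (hDc : D.Countable) (hDd : Dense D) :
    AmpleAction (M.approxSubgroup D S hD) (M.approxClosure D S hD) := by
  classical
  let c : Finset (M.approxSet D S hD) → Finset X := Finset.image Subtype.val
  have hc : ∀ F : Finset (M.approxSet D S hD), ((c F : Finset X) : Set X) =
      Subtype.val '' (F : Set (M.approxSet D S hD)) :=
    fun F => Finset.coe_image
  have hcD : ∀ F : Finset (M.approxSet D S hD), ((c F : Finset X) : Set X) ⊆ D := fun F => by
    rw [hc]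
    rintro _ ⟨x, -, rfl⟩
    exact x.2
  have hmem : ∀ {F : Finset (M.approxSet D S hD)} {d}, d ∈ F → (d : X) ∈ c F :=
    fun h => Finset.mem_image_of_mem _ h
  have happrox : ∀ (g : M.approxSubgroup D S hD) (F : Finset X), (F : Set X) ⊆ D → ∃ s ∈ S,
      ∀ x ∈ F, s • x = (g : M.aut) • x := fun g F hF => by
    obtain ⟨s, hs, h⟩ := g.2 F hF
    exact ⟨s, hs, fun x hx => (h x hx).1⟩
  refine ⟨fun s x hx => M.subset_gen _ (Set.mem_image_of_mem _ hx), fun s t hst x hx => ?_,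
    smul_approxClosure, fun g s hs d hd => ?_, approxSet_complete hDc hDd, fun n F g => ?_,
    fun A B C hAB hAC => ?_⟩
  · refine gen_subset ?_ hx
    rintro _ ⟨y, hy, rfl⟩
    exact hst hy
  · refine Subtype.ext (fix_gen (g : M.aut) _ ?_ _ hd)
    rintro _ ⟨y, hy, rfl⟩
    exact congrArg Subtype.val (hs y hy)
  · choose s hs hsF using fun i => happrox (g i) (c F) (hcD F)
    obtain ⟨N, hFN, hND, h, hh⟩ := hDS.locallyFinite (c F) n s (hcD F) hs
    have hN : ∃ N' : Finset (M.approxSet D S hD), c N' = N :=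
      ⟨N.attach.image fun x : {x // x ∈ N} => ⟨(x : X), hND x.2⟩, by
        simp [c, Finset.image_image, Function.comp_def]⟩
    obtain ⟨N', rfl⟩ := hN
    refine ⟨N', fun x hx => ?_, fun i => ⟨h i, le_approxSubgroup (hh i).1⟩, fun i =>
      ⟨fun d hd => Subtype.ext (((hh i).2.1 d (hmem hd)).trans (hsF i d (hmem hd))), ?_⟩⟩
    · obtain ⟨y, hy, hyx⟩ := Finset.mem_image.1 (hFN (hmem hx))
      rwa [← Subtype.ext hyx]
    · rw [smul_approxClosure_eq_iff, ← hc]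
      exact (hh i).2.2
  · have hsub : ∀ B : Finset (M.approxSet D S hD), (A : Set _) ⊆ M.approxClosure D S hD B →
        ((c A : Finset X) : Set X) ⊆ M.gen (c B : Finset X) := fun B h => by
      rw [hc, hc]
      rintro _ ⟨x, hx, rfl⟩
      exact h hx
    obtain ⟨k, hk, hkA, hkQ⟩ := hDS.extension (c A) (c B) (c C) (hcD A) (hcD B) (hcD C)
      (hsub B hAB) (hsub C hAC)
    refine ⟨⟨k, le_approxSubgroup hk⟩, fun d hd => Subtype.ext (hkA d (hmem hd)),
      fun φ ψ hφA hφB hψC hφψ => ?_⟩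
    rw [smul_approxClosure_eq_iff, ← hc] at hφA hφB
    rw [smul_approxClosure_eq_iff, image_coe_smul, ← hc] at hψC
    obtain ⟨φ', hφ', hφ'B⟩ := happrox φ (c A ∪ c B) (by
      intro y hy
      rcases Finset.mem_union.1 (Finset.mem_coe.1 hy) with hy | hy
      exacts [hcD A hy, hcD B hy])
    obtain ⟨ψ', hψ', hψ'C⟩ := happrox ψ (c A ∪ (c C).image (k • ·)) (by
      intro y hy
      rcases Finset.mem_union.1 (Finset.mem_coe.1 hy) with hy | hy
      · exact hcD A hy
      obtain ⟨x, hx, rfl⟩ := Finset.mem_image.1 hy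
      exact hDS.smul_mem k hk x (hcD C hx))
    have e1 : ∀ x ∈ c A, φ' • x = (φ : M.aut) • x := fun x hx =>
      hφ'B x (Finset.mem_union_left _ hx)
    have e2 : ∀ x ∈ c B, φ' • x = (φ : M.aut) • x := fun x hx =>
      hφ'B x (Finset.mem_union_right _ hx)
    have e3 : ∀ x ∈ c A, ψ' • x = (ψ : M.aut) • x := fun x hx =>
      hψ'C x (Finset.mem_union_left _ hx)
    have e4 : ∀ x ∈ c C, ψ' • k • x = (ψ : M.aut) • k • x := fun x hx =>
      hψ'C _ (Finset.mem_union_right _ (Finset.mem_image_of_mem _ hx))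
    obtain ⟨χ, hχ, hχB, hχC⟩ := hkQ φ' hφ' ψ' hψ' ((smul_gen_congr e1).trans hφA)
      ((smul_gen_congr e2).trans hφB) ((smul_gen_congr (by
        rintro _ ⟨x, hx, rfl⟩
        exact e4 x hx)).trans hψC) (by
        intro x hx
        rw [e1 x hx, e3 x hx]
        obtain ⟨d, hd, rfl⟩ := Finset.mem_image.1 hx
        exact congrArg Subtype.val (hφψ d hd))
    exact ⟨⟨χ, le_approxSubgroup hχ⟩,
      fun d hd => Subtype.ext ((hχB d (hmem hd)).trans (e2 d (hmem hd))),
      fun d hd => Subtype.ext ((hχC d (hmem hd)).trans (e4 d (hmem hd)))⟩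

end Approx

/-- In the automorphism group, the eighth power of a symmetric countably syndetic set contains the
pointwise stabilizer of a finite set. -/
theorem exists_stabilizer_subset_pow [CompleteSpace X] [TopologicalSpace.SeparableSpace X]
    {M : MetricStructure L X} (hM : M.Homogeneous) (hlf : M.LocallyFiniteAut)
    (hext : M.ExtensionProperty) {W : Set M.aut} (hW : W⁻¹ = W) (hsyn : CountablySyndetic W) :
    ∃ F : Finset X, ∀ g : M.aut, (∀ x ∈ F, g • x = x) → g ∈ W ^ 8 := by
  classical
  obtain ⟨k, hk⟩ := hsyn
  obtain ⟨D₀, hD₀c, hD₀d⟩ := TopologicalSpace.exists_countable_dense X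
  obtain ⟨D, S, hDc, hD₀, hkS, hDS, hwit⟩ :=
    exists_isWitnessClosed hM hlf hext (W ^ 8) hD₀c (Set.countable_range k)
  have hDd : Dense D := hD₀d.mono hD₀
  let Γ := M.approxSubgroup D S hDS.smul_mem
  have : Countable (M.approxSet D S hDS.smul_mem) := hDc.to_subtype
  have := approxSet_faithful (hD := hDS.smul_mem) hDd
  have hSΓ : S ≤ Γ := le_approxSubgroup
  -- The translating elements `k n` were put into `S`, so the trace of `W` on `Γ` is still countably
  -- syndetic there.
  obtain ⟨F, hF⟩ := (hDS.ampleAction (hD := hDS.smul_mem) hDc hDd).exists_stabilizer_subset_pow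
    (W := (Γ.subtype ⁻¹' W)) (by
      ext g
      rw [Set.mem_inv, Set.mem_preimage, Set.mem_preimage, map_inv, ← Set.mem_inv, hW])
    (k := fun n => ⟨k n, hSΓ (hkS ⟨n, rfl⟩)⟩) (by
      refine Set.eq_univ_of_forall fun g => ?_
      obtain ⟨n, hn⟩ := Set.mem_iUnion.1
        (hk.symm ▸ Set.mem_univ (g : M.aut) : (g : M.aut) ∈ ⋃ n, k n • W)
      refine Set.mem_iUnion.2 ⟨n, ?_⟩
      rw [Set.mem_smul_set_iff_inv_smul_mem] at hn ⊢
      exact hn)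
  refine ⟨F.image (↑), hwit _ ?_ fun g hg hgF => ?_⟩
  · rw [Finset.coe_image]
    rintro _ ⟨x, -, rfl⟩
    exact x.2
  · have := hF ⟨g, hSΓ hg⟩ fun d hd => Subtype.ext (hgF d (Finset.mem_image_of_mem _ hd))
    have h2 := Set.mem_image_of_mem Γ.subtype this
    rw [Set.image_pow] at h2
    exact Set.pow_subset_pow_left (Set.image_preimage_subset _ _) h2

end MetricStructure

/-! ### Steinhaus sets -/

/-- Symmetry gives `1 ∈ S ^ 2`. Since `1` need not lie in `S`, only exponents of the same parity are
compared. -/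
theorem Set.pow_subset_pow_add_two_mul {G : Type u} [Group G] {S : Set G} (hS : S⁻¹ = S)
    (hne : S.Nonempty) (n j : ℕ) : S ^ n ⊆ S ^ (n + 2 * j) := by
  obtain ⟨w, hw⟩ := hne
  have hw' : w⁻¹ ∈ S := by rw [← hS]; simpa using hw
  have h2 : (1 : G) ∈ S ^ (2 * j) := by
    rw [pow_mul]
    refine Set.one_mem_pow ?_
    rw [pow_two]
    exact ⟨w, hw, w⁻¹, hw', mul_inv_cancel w⟩
  intro x hx
  rw [pow_add]
  exact ⟨x, hx, 1, h2, mul_one x⟩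

theorem CountablySyndetic.nonempty {G : Type u} [Group G] {S : Set G} (hS : CountablySyndetic S) :
    S.Nonempty := by
  obtain ⟨k, hk⟩ := hS
  obtain ⟨n, x, hx, -⟩ := Set.mem_iUnion.1 (hk.symm ▸ Set.mem_univ (1 : G) : (1 : G) ∈ ⋃ n, k n • S)
  exact ⟨x, hx⟩

namespace MetricStructure

variable {L : MetricSignature} {X : Type u} [MetricSpace X]

/-! ### The space of realizations of a type -/

open Filter in
-- Automorphisms fix real values, so real terms are constant along the sequence. Real arguments
-- therefore never move, and continuity for fixed real arguments is enough.
theorem tendsto_eval {M : MetricStructure L X} {V : Type v} {a b : V → X} {γ : ℕ → M.aut}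
    (h : ∀ i, Tendsto (fun n => γ n • a i) atTop (nhds (b i))) :
    (∀ t : PtTerm L V, Tendsto (fun n => γ n • t.eval M a) atTop (nhds (t.eval M b))) ∧
      ∀ t : RealTerm L V, t.eval M b = t.eval M a := by
  refine term_induction (fun x => by simpa only [eval_var] using h x) (fun f s t i hs ht => ?_)
    (fun r => by simp only [eval_const]) (fun s t hs ht => ?_) (fun f s t i hs ht => ?_)
  · simp only [eval_func, ht, ← funPt_smul]
    exact (((continuous_apply i).comp (M.continuous_funPt f _)).tendsto _).comp
      (tendsto_pi_nhds.2 hs)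
  · simp only [eval_dist]
    refine tendsto_nhds_unique (hs.dist ht) ?_
    simp only [dist_smul]
    exact tendsto_const_nhds
  · simp only [eval_real_func, ht]
    refine tendsto_nhds_unique ((((continuous_apply i).comp
      (M.continuous_funReal f _)).tendsto _).comp (tendsto_pi_nhds.2 hs)) ?_
    simp only [Function.comp_def, funReal_smul]
    exact tendsto_const_nhds

open Filter in
theorem qftp_eq_of_tendsto {M : MetricStructure L X} {V : Type v} {a b : V → X} {γ : ℕ → M.aut}
    (h : ∀ i, Tendsto (fun n => γ n • a i) atTop (nhds (b i))) : M.qftp b = M.qftp a := by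
  obtain ⟨hpt, hreal⟩ := tendsto_eval h
  ext φ
  change φ.Holds M b ↔ φ.Holds M a
  induction φ with
  | eqPt s t =>
    have := hreal (.dist s t)
    simp only [eval_dist] at this
    simp only [QFFormula.Holds]
    rw [← dist_eq_zero, this, dist_eq_zero]
  | eqReal s t => simp only [QFFormula.Holds, hreal]
  | rel R s t =>
    simp only [QFFormula.Holds, hreal]
    -- Closedness alone gives the passage from `a` to `b`. The converse uses `(γ n)⁻¹`, which
    -- carries the terms at `b` to points converging to the terms at `a`.
    constructor
    · intro hR
      have hv : Tendsto (fun n j => (γ n)⁻¹ • (s j).eval M b) atTop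
          (nhds fun j => (s j).eval M a) := by
        refine tendsto_pi_nhds.2 fun j => tendsto_iff_dist_tendsto_zero.2 ?_
        refine (tendsto_iff_dist_tendsto_zero.1 (hpt (s j))).congr fun n => ?_
        rw [← dist_smul (γ n)⁻¹, inv_smul_smul, dist_comm]
      exact (M.isClosed_rel R _).mem_of_tendsto hv
        (Eventually.of_forall fun n => (rel_smul (γ n)⁻¹ R _ _).2 hR)
    · intro hR
      exact (M.isClosed_rel R _).mem_of_tendsto (tendsto_pi_nhds.2 fun j => hpt (s j))
        (Eventually.of_forall fun n => (rel_smul (γ n) R _ _).2 hR)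
  | not φ ih => simp only [QFFormula.Holds, ih]
  | or φ ψ h1 h2 => simp only [QFFormula.Holds, h1, h2]

theorem Homogeneous.exists_smul_eq {M : MetricStructure L X} (hM : M.Homogeneous) {V : Type v}
    [Finite V] {a b : V → X} (h : b ∈ M.realizations (M.qftp a)) : ∃ g : M.aut, g • a = b := by
  obtain ⟨g, hg⟩ := hM.exists_aut_of_finite (mem_realizations_qftp.1 h).symm
  exact ⟨g, funext hg⟩

theorem smul_mem_realizations {M : MetricStructure L X} {V : Type v} {a b : V → X} (g : M.aut)
    (h : b ∈ M.realizations (M.qftp a)) : g • b ∈ M.realizations (M.qftp a) :=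
  mem_realizations_qftp.2 ((qftp_smul g b).trans (mem_realizations_qftp.1 h))

theorem self_mem_realizations {M : MetricStructure L X} {V : Type v} (a : V → X) :
    a ∈ M.realizations (M.qftp a) := mem_realizations_qftp.2 rfl

theorem Homogeneous.isClosed_realizations {M : MetricStructure L X} (hM : M.Homogeneous)
    {k : ℕ} (a : Fin k → X) : IsClosed (M.realizations (M.qftp a)) := by
  refine isClosed_of_closure_subset fun b hb => ?_
  obtain ⟨c, hc, hcb⟩ := mem_closure_iff_seq_limit.1 hb
  choose γ hγ using fun n => hM.exists_smul_eq (hc n)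
  refine mem_realizations_qftp.2 (qftp_eq_of_tendsto (γ := γ) fun i => ?_)
  refine (tendsto_pi_nhds.1 hcb i).congr fun n => ?_
  rw [← hγ n]
  rfl

/-- The action of an automorphism on the realizations of a type. -/
def realizationsHomeomorph {M : MetricStructure L X} {k : ℕ} (a : Fin k → X) (g : M.aut) :
    M.realizations (M.qftp a) ≃ₜ M.realizations (M.qftp a) where
  toFun b := ⟨g • b.1, smul_mem_realizations g b.2⟩
  invFun b := ⟨g⁻¹ • b.1, smul_mem_realizations g⁻¹ b.2⟩
  left_inv b := Subtype.ext (inv_smul_smul g b.1)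
  right_inv b := Subtype.ext (smul_inv_smul g b.1)
  continuous_toFun := (continuous_subtype_val.const_smul g).subtype_mk _
  continuous_invFun := (continuous_subtype_val.const_smul g⁻¹).subtype_mk _

/-- The realizations form a single orbit and a complete metric space, covered by countably many
homeomorphic translates of the orbit of `a` under `S`. -/
theorem Homogeneous.not_isMeagre_orbit [CompleteSpace X] {M : MetricStructure L X}
    (hM : M.Homogeneous) {S : Set M.aut} (hS : CountablySyndetic S) {k : ℕ} (a : Fin k → X) :
    ¬ IsMeagre {b : M.realizations (M.qftp a) | ∃ w ∈ S, w • a = b.1} := by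
  intro hZ
  obtain ⟨t, ht⟩ := hS
  have : CompleteSpace (M.realizations (M.qftp a)) := (hM.isClosed_realizations a).completeSpace_coe
  have h := isMeagre_iUnion fun n => hZ.preimage_of_isOpenMap
    (realizationsHomeomorph a (t n)⁻¹).continuous (realizationsHomeomorph a (t n)⁻¹).isOpenMap
  refine not_isMeagre_of_isOpen isOpen_univ ⟨⟨a, self_mem_realizations a⟩, trivial⟩ (h.mono ?_)
  intro b _
  obtain ⟨g, hg⟩ := hM.exists_smul_eq b.2
  obtain ⟨n, hn⟩ := Set.mem_iUnion.1 (ht.symm ▸ Set.mem_univ g : g ∈ ⋃ n, t n • S)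
  refine Set.mem_iUnion.2 ⟨n, (t n)⁻¹ * g, Set.mem_smul_set_iff_inv_smul_mem.1 hn, ?_⟩
  rw [mul_smul, hg]
  rfl

theorem continuous_aut_smul {M : MetricStructure L X} (x : X) : Continuous fun g : M.aut => g • x :=
  (continuous_apply x).comp continuous_induced_dom

/-! ### Weakly isolated sequences -/

/-- Elements moving `a` inside a relatively saturated set are products of stabilizing elements and
two elements of `S`. -/
theorem MRelSaturated.exists_factorization {M : MetricStructure L X} (hM : M.Homogeneous)
    {S : Set M.aut} (hS : S⁻¹ = S) {t : M.aut} {k : ℕ} {ε : ℝ} {a : Fin k → X}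
    {T Y : Set (Fin k → X)} (hε : 0 < ε) (haY : a ∈ Y) (hTY : M.TRelSaturated ε a T Y)
    (hY : ∀ b ∈ Y, (∀ i, dist (a i) (b i) < ε) → ∃ g ∈ t • S, g • a = b)
    {g : M.aut} (hgT : g • a ∈ T) (hgε : ∀ i, dist ((g • a) i) (a i) < ε) :
    ∃ p ∈ MulAction.stabilizer M.aut a, ∃ s ∈ S ^ 2, ∃ q ∈ MulAction.stabilizer M.aut a,
      g = p * s * q := by
  obtain ⟨_, ⟨h, hh, rfl⟩, hha⟩ := hY a haY (by simpa using fun _ => hε)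
  obtain ⟨b, hbY, hb⟩ := hTY _ hgT hgε
  have hd : ∀ i, dist (a i) (b i) < ε := fun i => by
    have := eval_real_eq_of_qftp_eq hb (.dist (.var (.inl i)) (.var (.inr i)))
    simp only [eval_dist, eval_var, Sum.elim_inl, Sum.elim_inr] at this
    rw [dist_comm, ← this]
    exact hgε i
  obtain ⟨_, ⟨h', hh', rfl⟩, hb'⟩ := hY b hbY hd
  obtain ⟨f, hf⟩ := hM.exists_aut_of_finite hb.symm
  have hfb : f • b = g • a := funext fun i => hf (.inl i)
  have hfa : f • a = a := funext fun i => hf (.inr i)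
  simp only [smul_eq_mul] at hha hb'
  refine ⟨f * (t * h), ?_, h⁻¹ * h', ?_, (f * (t * h'))⁻¹ * g, ?_, by group⟩
  · rw [MulAction.mem_stabilizer_iff, mul_smul, hha, hfa]
  · rw [pow_two]
    exact Set.mul_mem_mul (by rw [← hS]; simpa using hh) hh'
  · rw [MulAction.mem_stabilizer_iff, mul_smul, inv_smul_eq_iff, mul_smul, hb', hfb]

/-- Between consecutive factors two elements of `H` merge into one, which costs `S ^ 8`. Each factor
thus costs `4 + 8 = 12`, with a single leading `H` left over. -/
theorem conj_list_prod_mem {G : Type u} [Group G] (H : Subgroup G) {S : Set G}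
    (hH : (H : Set G) ⊆ S ^ 8) (w : G) (l : List G)
    (hl : ∀ c ∈ l, w⁻¹ * c * w ∈ (H : Set G) * S ^ 4 * H) :
    ∀ s ∈ H, w⁻¹ * l.prod * w * s ∈ (H : Set G) * S ^ (12 * l.length) := by
  induction l with
  | nil =>
    intro s hs
    refine ⟨s, hs, 1, by simp, by simp⟩
  | cons c l ih =>
    intro s hs
    obtain ⟨p, hp, q, hq, hpq⟩ := ih (fun c hc => hl c (by simp [hc])) s hs
    obtain ⟨_, ⟨x, hx, y, hy, rfl⟩, z, hz, hxyz⟩ := hl c (by simp)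
    have hpq : p * q = w⁻¹ * l.prod * w * s := hpq
    have hxyz : x * y * z = w⁻¹ * c * w := hxyz
    refine ⟨x, hx, y * ((z * p) * q), ?_, ?_⟩
    · have : 12 * (c :: l).length = 4 + (8 + 12 * l.length) := by
        rw [List.length_cons]; ring
      rw [this, pow_add, pow_add]
      exact Set.mul_mem_mul hy (Set.mul_mem_mul (hH (H.mul_mem hz hp)) hq)
    · change x * (y * (z * p * q)) = _
      rw [List.prod_cons]
      calc x * (y * (z * p * q)) = (x * y * z) * (p * q) := by group
        _ = _ := by rw [hpq, hxyz]; group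

theorem Homogeneous.exists_isOpen_subset_pow [CompleteSpace X]
    [TopologicalSpace.SeparableSpace X] {M : MetricStructure L X} (hM : M.Homogeneous)
    (hlf : M.LocallyFiniteAut) (hext : M.ExtensionProperty) {m : ℕ}
    (hm : M.AdmitsMWeaklyIsolated m) {S : Set M.aut} (hS : S⁻¹ = S) (hsyn : CountablySyndetic S) :
    ∃ U : Set M.aut, IsOpen U ∧ U.Nonempty ∧ U ⊆ S ^ (12 * m + 8) := by
  obtain ⟨F, hF⟩ := exists_stabilizer_subset_pow hM hlf hext hS hsyn
  let a : Fin F.card → X := fun i => F.equivFin.symm i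
  have ha : (MulAction.stabilizer M.aut a : Set M.aut) ⊆ S ^ 8 := by
    intro g hg
    refine hF g fun x hx => ?_
    have := congrFun (MulAction.mem_stabilizer_iff.1 hg) (F.equivFin ⟨x, hx⟩)
    simpa [a] using this
  obtain ⟨s, ⟨-, ε, Y, hY, hsim⟩, hsZ⟩ := hm _ a _ (hM.not_isMeagre_orbit hsyn a)
  obtain ⟨t, ht⟩ := hsyn
  -- Otherwise choose for each `n` a target `b n` not reached from `t n • S`. Isolation reaches all
  -- of them by one automorphism, which lies in some `t n • S`.
  have hn : ∃ n, ∀ b ∈ Y n, (∀ i, dist (s n i) (b i) < ε n) → ∃ g ∈ t n • S, g • s n = b := by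
    by_contra! hcon
    choose b hbY hbε hb using hcon
    obtain ⟨g, hg, hgb⟩ := hsim b fun n =>
      ⟨hbY n, mem_realizations_qftp.1 ((hY n).2.2.1 (hbY n)), hbε n⟩
    obtain ⟨n, hn⟩ := Set.mem_iUnion.1
      (ht.symm ▸ Set.mem_univ (⟨g, hg⟩ : M.aut) : (⟨g, hg⟩ : M.aut) ∈ ⋃ n, t n • S)
    exact hb n _ hn (funext fun i => hgb n i)
  obtain ⟨n, hn⟩ := hn
  obtain ⟨hε, -, -, hsY, T, -, hTY, U, hU, ⟨u, hu⟩, hUg⟩ := hY n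
  obtain ⟨_, ⟨w, hw, hwa⟩, hsn⟩ := hsZ n
  rw [hsn] at hwa
  have hw' : w⁻¹ ∈ S := by rw [← hS]; simpa using hw
  have hstab : ∀ q ∈ MulAction.stabilizer M.aut (s n),
      w⁻¹ * q * w ∈ MulAction.stabilizer M.aut a := fun q hq => by
    rw [MulAction.mem_stabilizer_iff] at hq ⊢
    rw [mul_smul, mul_smul, hwa, hq, ← hwa, inv_smul_smul]
  -- Since `s n = w a` with `w ∈ S`, this map pulls the open set generated around `s n` back to an
  -- open set of automorphisms, while stabilizers of `s n` are conjugated by `w` into the stabilizer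
  -- of `a`.
  let e : M.aut → M.realizations (M.qftp (s n)) := fun g =>
    ⟨(w * g) • a, by
      rw [← hwa]
      exact mem_realizations_qftp.2 ((qftp_smul _ a).trans (qftp_smul w a).symm)⟩
  have he : Continuous e := by
    refine Continuous.subtype_mk (continuous_pi fun i => ?_) _
    have : Continuous fun g : M.aut => w • g • a i := (continuous_aut_smul (a i)).const_smul w
    exact this.congr fun g => by rw [Pi.smul_apply, mul_smul]
  refine ⟨e ⁻¹' U, hU.preimage he, ?_, ?_⟩
  · obtain ⟨g, hg⟩ := hM.exists_smul_eq u.2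
    refine ⟨w⁻¹ * g * w, ?_⟩
    have : e (w⁻¹ * g * w) = u := Subtype.ext (by
      change (w * (w⁻¹ * g * w)) • a = u.1
      rw [← hg, ← hwa, smul_smul]
      congr 1
      group)
    rwa [Set.mem_preimage, this]
  · intro g hg
    obtain ⟨c, hc, hcT⟩ := hUg _ hg
    have hc' : (List.ofFn c).reverse.prod • s n = (w * g) • a := funext hc
    have hl : ∀ x ∈ (List.ofFn c).reverse,
        w⁻¹ * x * w ∈ (MulAction.stabilizer M.aut a : Set M.aut) * S ^ 4 *
          (MulAction.stabilizer M.aut a : Set M.aut) := by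
      intro x hx
      obtain ⟨i, rfl⟩ := (List.mem_ofFn' _ _).1 (List.mem_reverse.1 hx)
      obtain ⟨p, hp, r, hr, q, hq, hpq⟩ :=
        MRelSaturated.exists_factorization hM hS hε hsY hTY hn (hcT i).1 (hcT i).2
      refine ⟨_, ⟨w⁻¹ * p * w, hstab p hp, w⁻¹ * r * w, ?_, rfl⟩, _, hstab q hq, ?_⟩
      · have : S ^ 4 = S * S ^ 2 * S := by rw [← pow_succ', ← pow_succ]
        rw [this]
        exact Set.mul_mem_mul (Set.mul_mem_mul hw' hr) hw
      · change w⁻¹ * p * w * (w⁻¹ * r * w) * (w⁻¹ * q * w) = _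
        rw [hpq]
        group
    -- The conjugated product and `g` agree on `a`, so they differ by an element of the stabilizer,
    -- which is absorbed as the trailing factor.
    have := conj_list_prod_mem _ ha w _ hl
      ((w⁻¹ * (List.ofFn c).reverse.prod * w)⁻¹ * g) (by
        rw [MulAction.mem_stabilizer_iff, mul_smul, inv_smul_eq_iff, mul_smul, mul_smul, hwa, hc',
          mul_smul, inv_smul_smul])
    rw [mul_inv_cancel_left, List.length_reverse, List.length_ofFn] at this
    rw [add_comm, pow_add]
    exact Set.mul_subset_mul_right ha this

/-! ### Isolated sequences -/

theorem eval_rename {M : MetricStructure L X} {V : Type v} {W : Type w} (h : V → W) (b : W → X) :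
    (∀ t : PtTerm L V, (t.rename h).eval M b = t.eval M (b ∘ h)) ∧
      ∀ t : RealTerm L V, (t.rename h).eval M b = t.eval M (b ∘ h) := by
  refine term_induction (fun x => ?_) (fun f s t i hs ht => ?_) (fun r => ?_)
    (fun s t hs ht => ?_) (fun f s t i hs ht => ?_)
  · simp only [PtTerm.rename, eval_var, Function.comp_apply]
  · simp only [PtTerm.rename, eval_func, hs, ht]
  · simp only [RealTerm.rename, eval_const]
  · simp only [RealTerm.rename, eval_dist, hs, ht]
  · simp only [RealTerm.rename, eval_real_func, hs, ht]

theorem holds_rename {M : MetricStructure L X} {V : Type v} {W : Type w} (h : V → W) (b : W → X)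
    (φ : QFFormula L V) : (φ.rename h).Holds M b ↔ φ.Holds M (b ∘ h) := by
  induction φ with
  | eqPt s t => simp only [QFFormula.rename, QFFormula.Holds, (eval_rename h b).1]
  | eqReal s t => simp only [QFFormula.rename, QFFormula.Holds, (eval_rename h b).2]
  | rel R s t =>
    simp only [QFFormula.rename, QFFormula.Holds, (eval_rename h b).1, (eval_rename h b).2]
  | not φ ih => simp only [QFFormula.rename, QFFormula.Holds, ih]
  | or φ ψ h1 h2 => simp only [QFFormula.rename, QFFormula.Holds, h1, h2]

theorem RelSaturated.exists_qftpOver_eq {M : MetricStructure L X} {k : ℕ} {ε : ℝ} {a : Fin k → X}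
    {Y : Set (Fin k → X)} (hY : M.RelSaturated ε a Y) {b : Fin k → X}
    (hb : b ∈ M.realizations (M.qftp a)) (hε : ∀ i, dist (b i) (a i) < ε) :
    ∃ b' ∈ Y, M.qftpOver b a = M.qftpOver b' a := by
  have htype : M.IsEpsType ε a (M.qftpOver b a) := by
    refine ⟨fun φ hφ => (holds_rename Sum.inl _ φ).2 (hb φ hφ), fun i =>
      ⟨dist (b i) (a i), dist_nonneg, hε i, ?_⟩⟩
    change RealTerm.eval M _ _ = RealTerm.eval M _ _
    simp only [eval_dist, eval_var, eval_const, Sum.elim_inl, Sum.elim_inr]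
  obtain ⟨b', hb', h⟩ := hY.2 _ htype ⟨b, self_mem_realizations _⟩
  exact ⟨b', hb', (mem_realizations_qftp.1 h).symm⟩

/-- Take `T` to be all realizations and `U` the `ε n`-ball around `s n`: full saturation covers `T`,
and by homogeneity one automorphism reaches each point of `U`. -/
theorem AdmitsIsolated.admitsMWeaklyIsolated_one {M : MetricStructure L X} (hM : M.Homogeneous)
    (h : M.AdmitsIsolated) : M.AdmitsMWeaklyIsolated 1 := by
  intro k a Z hZ
  obtain ⟨s, ⟨hs, ε, Y, hY, hsim⟩, hsZ⟩ := h k a Z hZ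
  refine ⟨s, ⟨hs, ε, Y, fun n => ⟨(hY n).1, (hY n).2.1, (hY n).2.2.1, ?_,
    M.realizations (M.qftp (s n)), subset_rfl, fun b hb hbε => (hY n).2.2.exists_qftpOver_eq hb hbε,
    ?_⟩, hsim⟩, hsZ⟩
  -- The type of `s n` over itself contains the equations `x_i = a_i`, so its only realization is `s
  -- n`.
  · obtain ⟨b, hbY, hb⟩ := (hY n).2.2.exists_qftpOver_eq (self_mem_realizations (s n))
      (by simpa using fun _ => (hY n).1)
    have : b = s n := funext fun i => by
      have := eval_eq_iff_of_qftp_eq hb (.var (.inl i)) (.var (.inr i))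
      simpa only [eval_var, Sum.elim_inl, Sum.elim_inr, true_iff] using this
    rwa [← this]
  · refine ⟨{b | ∀ i, dist (b.1 i) (s n i) < ε n}, ?_,
      ⟨⟨s n, self_mem_realizations _⟩, fun i => by simpa using (hY n).1⟩, fun b hb => ?_⟩
    · rw [Set.ofPred_forall]
      refine isOpen_iInter_of_finite fun i => isOpen_lt ?_ continuous_const
      exact (((continuous_apply i).comp continuous_subtype_val).dist continuous_const)
    · obtain ⟨g, hg⟩ := hM.exists_smul_eq b.2
      have hgi : ∀ i, g.1 (s n i) = b.1 i := fun i => congrFun hg i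
      refine ⟨fun _ => g, by simpa using hgi, fun _ => ⟨?_, fun j => ?_⟩⟩
      · exact smul_mem_realizations g (self_mem_realizations (s n))
      · rw [hgi]
        exact hb j

instance aut_continuousConstSMul (M : MetricStructure L X) : ContinuousConstSMul M.aut M.aut where
  continuous_const_smul g := by
    refine continuous_induced_rng.2 (continuous_pi fun x => ?_)
    exact (continuous_aut_smul x).const_smul g

end MetricStructure

/-! ### Automatic continuity -/

open Topology in
theorem exists_nhds_one_pow_subset {H : Type v} [Group H] [TopologicalSpace H]
    [IsTopologicalGroup H] {O : Set H} (hO : O ∈ 𝓝 (1 : H)) (n : ℕ) :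
    ∃ V ∈ 𝓝 (1 : H), V⁻¹ = V ∧ V ^ n ⊆ O := by
  have key : ∀ j : ℕ, ∃ V ∈ 𝓝 (1 : H), V⁻¹ = V ∧ V ^ (2 ^ j) ⊆ O := by
    intro j
    induction j with
    | zero =>
      obtain ⟨V, hV, -, hVi, hVO⟩ := exists_closed_nhds_one_inv_eq_mul_subset hO
      refine ⟨V, hV, hVi, ?_⟩
      rw [pow_zero, pow_one]
      exact (Set.subset_mul_left V (mem_of_mem_nhds hV)).trans hVO
    | succ j ih =>
      obtain ⟨V, hV, -, hVO⟩ := ih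
      obtain ⟨W, hW, -, hWi, hWV⟩ := exists_closed_nhds_one_inv_eq_mul_subset hV
      refine ⟨W, hW, hWi, ?_⟩
      rw [pow_succ', pow_mul, pow_two]
      exact (Set.pow_subset_pow_left hWV).trans hVO
  obtain ⟨V, hV, hVi, hVO⟩ := key n
  exact ⟨V, hV, hVi, (Set.pow_subset_pow_right (mem_of_mem_nhds hV)
    Nat.lt_two_pow_self.le).trans hVO⟩

open Topology in
-- Preimages of `V ^ 2` are symmetric and countably syndetic by separability, so a power of one
-- contains an open `U`; then `u⁻¹ U` is a neighbourhood of `1` with small image. Only left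
-- translations of `G` need to be continuous.
theorem IsSteinhausWith.automaticContinuity {G : Type u} [Group G] [TopologicalSpace G]
    [ContinuousConstSMul G G] {k : ℕ} (hG : IsSteinhausWith G k) :
    AutomaticContinuity.{u, v} G := by
  classical
  intro H _ _ _ _ φ
  refine continuous_iff_continuousAt.2 fun g O hO => ?_
  have hO' : {h | φ g * h ∈ O} ∈ 𝓝 (1 : H) :=
    (continuous_const_mul (φ g)).continuousAt.preimage_mem_nhds (by simpa using hO)
  -- The image of `U` lies in `(V ^ 2) ^ k`, and `u⁻¹ U` uses this twice.
  obtain ⟨V, hV, hVi, hVO⟩ := exists_nhds_one_pow_subset hO' (2 * k + 2 * k)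
  have hS : (φ ⁻¹' (V ^ 2))⁻¹ = φ ⁻¹' (V ^ 2) := by
    ext x
    rw [Set.mem_inv, Set.mem_preimage, Set.mem_preimage, map_inv, ← Set.mem_inv, ← inv_pow, hVi]
  have hsyn : CountablySyndetic (φ ⁻¹' (V ^ 2)) := by
    let d := TopologicalSpace.denseSeq H
    -- The dense sequence need not lie in the image of `φ`, so each `d n V` meeting the image is
    -- represented by a point of `G`. Comparing two points of the same `d n V` costs `V ^ 2`.
    let a : ℕ → G := fun n => if h : ∃ x, (d n)⁻¹ * φ x ∈ V then h.choose else 1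
    refine ⟨a, Set.eq_univ_of_forall fun x => ?_⟩
    have hx : {h | h⁻¹ * φ x ∈ V} ∈ 𝓝 (φ x) :=
      (continuous_inv.mul continuous_const).continuousAt.preimage_mem_nhds (by simpa using hV)
    obtain ⟨n, hn⟩ := (TopologicalSpace.denseRange_denseSeq H).exists_mem_open
      isOpen_interior ⟨φ x, mem_interior_iff_mem_nhds.2 hx⟩
    have hn : (d n)⁻¹ * φ x ∈ V := (interior_subset hn :)
    have hex : ∃ x, (d n)⁻¹ * φ x ∈ V := ⟨x, hn⟩
    have ha : (d n)⁻¹ * φ (a n) ∈ V := by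
      simp only [a, dif_pos hex]
      exact hex.choose_spec
    refine Set.mem_iUnion.2 ⟨n, Set.mem_smul_set_iff_inv_smul_mem.2 ?_⟩
    have ha' : ((d n)⁻¹ * φ (a n))⁻¹ ∈ V := by rw [← hVi]; simpa using ha
    have := Set.mul_mem_mul ha' hn
    rw [← pow_two] at this
    simpa [mul_assoc] using this
  obtain ⟨U, hU, ⟨u, hu⟩, hUS⟩ := hG.2 _ hS hsyn
  have hpow : ∀ x ∈ U, φ x ∈ V ^ (2 * k) := fun x hx => by
    have h1 := Set.mem_image_of_mem φ (hUS hx)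
    rw [Set.image_pow] at h1
    rw [pow_mul]
    exact Set.pow_subset_pow_left (Set.image_preimage_subset _ _) h1
  have hN : {x | (u * g⁻¹) * x ∈ U} ∈ 𝓝 g :=
    (continuous_const_smul (u * g⁻¹)).continuousAt.preimage_mem_nhds
      (hU.mem_nhds (by simpa using hu))
  rw [Filter.mem_map]
  filter_upwards [hN] with x hx
  have h1 : (φ u)⁻¹ ∈ V ^ (2 * k) := by
    rw [← hVi, inv_pow]
    simpa using hpow u hu
  have h2 : (φ u)⁻¹ * φ (u * g⁻¹ * x) ∈ V ^ (2 * k + 2 * k) := by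
    rw [pow_add]
    exact Set.mul_mem_mul h1 (hpow _ hx)
  have h3 : φ g * ((φ u)⁻¹ * φ (u * g⁻¹ * x)) ∈ O := hVO h2
  have h4 : φ g * ((φ u)⁻¹ * φ (u * g⁻¹ * x)) = φ x := by
    simp only [map_mul, map_inv]
    group
  rw [h4] at h3
  exact h3

theorem mainTheorem2 {L : MetricSignature} {X : Type u} [MetricSpace X]
    [TopologicalSpace.SeparableSpace X] [CompleteSpace X] (M : MetricStructure L X)
    (hhom : M.Homogeneous) (hlf : M.LocallyFiniteAut) (hext : M.ExtensionProperty) :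
    (∀ m : ℕ, M.AdmitsMWeaklyIsolated m → IsSteinhausWith M.aut (24 * m + 10)) ∧
    (M.AdmitsIsolated → IsSteinhausWith M.aut 24) ∧
    (M.AdmitsWeaklyIsolated → AutomaticContinuity.{u, v} M.aut) := by
  -- The argument gives exponent `12 m + 8`. The required exponents exceed it by the even numbers
  -- `12 m + 2` and, for `m = 1`, `4`.
  have hmain : ∀ m j : ℕ, M.AdmitsMWeaklyIsolated m →
      IsSteinhausWith M.aut (12 * m + 8 + 2 * j) := by
    refine fun m j hm => ⟨by omega, fun S hS hsyn => ?_⟩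
    obtain ⟨U, hU, hne, hUS⟩ := hhom.exists_isOpen_subset_pow hlf hext hm hS hsyn
    exact ⟨U, hU, hne, hUS.trans (Set.pow_subset_pow_add_two_mul hS hsyn.nonempty _ j)⟩
  refine ⟨fun m hm => ?_, fun h => ?_, fun ⟨m, hm⟩ => (hmain m 0 hm).automaticContinuity⟩
  · have := hmain m (6 * m + 1) hm
    rwa [show 12 * m + 8 + 2 * (6 * m + 1) = 24 * m + 10 by ring] at this
  · exact hmain 1 2 (h.admitsMWeaklyIsolated_one hhom)
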